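/- Let $\nu\ge 1$. Call a $\nu$-tuple of formal series in $\mathbb{C}[[z_1,\dots,z_\nu]]$ \emph{convergent} if each component converges absolutely on some polydisc of positive radius centred at $0$ (so convergent tuples are the Taylor expansions of holomorphic germs at $0$). Let $a=(a_1,\dots,a_\nu)$ be a $\nu$-tuple of formal series whose components contain only monomials $z^m=z_1^{m_1}\cdots z_\nu^{m_\nu}$ of total degree $|m|=m_1+\cdots+m_\nu\ge 2$; a tuple $h$ is \emph{tangent to the identity} if $h-\mathrm{id}$ has this property. (i) Let $q\in(\mathbb{C}^*)^\nu$, let $R_q(z)=(q_1z_1,\dots,q_\nu z_\nu)$, and suppose that $g=R_q\circ(\mathrm{id}+a)$ is convergent, i.e. is a germ of holomorphic diffeomorphism of $(\mathbb{C}^\nu,0)$. Suppose that $q$ is non-resonant, i.e. $q_i\ne q^m$ for all $i\in\{1,\dots,\nu\}$ and all $m\in\mathbb{N}^\nu$ with $|m|\ge 2$, and that $q$ satisfies the Bruno condition $$\mathcal{B}(q)=\sum_{k\ge 1}\Big(\frac1k-\frac1{k+1}\Big)\log\frac{1}{\Omega(k)}<\infty,$$ where $\Omega(k)=\min\big(\{1\}\cup\{\,d(m\cdot\lambda-\lambda_j,\mathbb{Z})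 : 1\le j\le\nu,\ m\in\mathbb{N}^\nu,\ 2\le|m|\le k+1\,\}\big)$, $m\cdot\lambda=m_1\lambda_1+\cdots+m_\nu\lambda_\nu$, $d(\cdot,\mathbb{Z})$ is the distance in $\mathbb{C}$ to $\mathbb{Z}$, and $\lambda\in\mathbb{C}^\nu$ is any vector with $q_j=e^{2\pi i\lambda_j}$ for all $j$ (the value of $\Omega(k)$ does not depend on this choice). Then there is a unique tangent-to-identity $\nu$-tuple $h$ of formal series such that $g\circ h=h\circ R_q$, and $h$ is convergent. (ii) Let $\lambda\in\mathbb{C}^\nu$, let $V_\lambda(z)=(\lambda_1z_1,\dots,\lambda_\nu z_\nu)$, and suppose that the vector field $V=V_\lambda+a$ is convergent. Suppose that $\lambda$ is non-resonant, i.e. $\lambda_i\ne m\cdot\lambda$ for all $i\in\{1,\dots,\nu\}$ and all $m\in\mathbb{N}^\nu$ with $|m|\ge 2$, and that $\lambda$ satisfies the Bruno condition $$\mathcal{B}_{v.f.}(\lambda)=\sum_{k\ge 1}\Big(\frac1k-\frac1{k+1}\Big)\log\frac{1}{\Omega_{v.f.}(k)}<\infty,$$ where $\Omega_{v.f.}(k)=\min\big(\{1\}\cup\{\,|m\cdot\lambda-\lambda_j|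 : 1\le j\le\nu,\ m\in\mathbb{N}^\nu,\ 2\le|m|\le k+1\,\}\big)$. Then there is a unique tangent-to-identity $\nu$-tuple $h$ of formal series that conjugates $V$ to its linear part, i.e. $\sum_{j=1}^{\nu}\lambda_j z_j\,\dfrac{\partial h_i}{\partial z_j}=V_i\circ h$ for $i=1,\dots,\nu$, and $h$ is convergent. -/

import Mathlib

noncomputable section

namespace BrunoLin

/-- `ν`-tuples of formal power series in `z_1, …, z_ν` over `ℂ`. -/
abbrev Tuple (ν : ℕ) : Type := Fin ν → MvPowerSeries (Fin ν) ℂ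

/-- The `ν`-tuples all of whose components have only terms of total degree at least `2`. -/
def nonlinearTuples (ν : ℕ) : Set (Tuple ν) :=
  {a | ∀ i (m : Fin ν →₀ ℕ), m.degree ≤ 1 → MvPowerSeries.coeff m (a i) = 0}

/-- The identity tuple `(z_1, …, z_ν)`. -/
def idTuple (ν : ℕ) : Tuple ν := fun i => MvPowerSeries.X i

/-- Formal diffeomorphisms tangent to the identity: tuples `id + a` with `a` of order at least `2`. -/
def tangentToId (ν : ℕ) : Set (Tuple ν) :=
  {h | h - idTuple ν ∈ nonlinearTuples ν}

/-- Composition `g ∘ h` of tuples of formal series (used for `h` without constant terms). -/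
def comp {ν : ℕ} (g h : Tuple ν) : Tuple ν := fun i => MvPowerSeries.subst h (g i)

/-- The diagonal linear map `(z_1, …, z_ν) ↦ (q_1 z_1, …, q_ν z_ν)`, as a tuple of series. This is
`R_q` for diffeomorphisms and the linear vector field `V_q` for vector fields. -/
def diagTuple {ν : ℕ} (q : Fin ν → ℂ) : Tuple ν :=
  fun i => MvPowerSeries.C (q i) * MvPowerSeries.X i

/-- A formal series converges if it is absolutely convergent on some polydisc of positive radius
centred at the origin. -/
def SeriesConvergent {ν : ℕ} (f : MvPowerSeries (Fin ν) ℂ) : Prop :=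
  ∃ r : ℝ, 0 < r ∧ Summable fun m : Fin ν →₀ ℕ => ‖MvPowerSeries.coeff m f‖ * r ^ m.degree

/-- A tuple is convergent (i.e. the expansion of a holomorphic germ) if all its components are. -/
def Convergent {ν : ℕ} (g : Tuple ν) : Prop := ∀ i, SeriesConvergent (g i)

/-- The monomial `q ^ m = q_1 ^ m_1 ⋯ q_ν ^ m_ν`. -/
def monomialValue {ν : ℕ} (q : Fin ν → ℂ) (m : Fin ν →₀ ℕ) : ℂ := ∏ i, q i ^ m i

/-- The pairing `m · lam = m_1 lam_1 + ⋯ + m_ν lam_ν`. -/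
def pairing {ν : ℕ} (m : Fin ν →₀ ℕ) (lam : Fin ν → ℂ) : ℂ := ∑ i, (m i : ℂ) * lam i

/-! ### Diffeomorphisms -/

/-- Non-resonance for the spectrum of a diffeomorphism. -/
def NonResonantDiffeo {ν : ℕ} (q : Fin ν → ℂ) : Prop :=
  ∀ (i : Fin ν) (m : Fin ν →₀ ℕ), 2 ≤ m.degree → q i ≠ monomialValue q m

/-- The distance of a complex number to the set of integers. -/
def distInt (w : ℂ) : ℝ := Metric.infDist w (Set.range ((↑) : ℤ → ℂ))

/-- The numbers over which the minimum `Ω(k)` is taken, for exponents `lam`. -/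
def smallDivisorsDiffeo {ν : ℕ} (lam : Fin ν → ℂ) (k : ℕ) : Set ℝ :=
  {1} ∪ {x | ∃ (j : Fin ν) (m : Fin ν →₀ ℕ), 2 ≤ m.degree ∧ m.degree ≤ k + 1 ∧
    x = distInt (pairing m lam - lam j)}

/-- Logarithms `lam_j` with `q_j = exp (2 π i lam_j)`. -/
def exponents {ν : ℕ} (q : Fin ν → ℂ) : Fin ν → ℂ :=
  fun j => Complex.log (q j) / (2 * Real.pi * Complex.I)

/-- `Ω(k)` for the spectrum `q` of a diffeomorphism. -/
def OmegaDiffeo {ν : ℕ} (q : Fin ν → ℂ) (k : ℕ) : ℝ :=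
  sInf (smallDivisorsDiffeo (exponents q) k)

/-- The Bruno series `B(q) = ∑_{k ≥ 1} (1/k - 1/(k+1)) log (1/Ω(k))`, a series of non-negative
terms with value in `[0, ∞]` (the summation index is shifted by one). -/
def BrunoSeriesDiffeo {ν : ℕ} (q : Fin ν → ℂ) : ENNReal :=
  ∑' k : ℕ, ENNReal.ofReal
    ((1 / ((k : ℝ) + 1) - 1 / ((k : ℝ) + 2)) * Real.log (1 / OmegaDiffeo q (k + 1)))

/-- `h` is a solution of the formal linearization problem for the formal diffeomorphism `g` with
linear part `R_q`: it is tangent to the identity and `g ∘ h = h ∘ R_q`. -/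
def LinearizesDiffeo {ν : ℕ} (q : Fin ν → ℂ) (g h : Tuple ν) : Prop :=
  h ∈ tangentToId ν ∧ comp g h = comp h (diagTuple q)

/-! ### Vector fields -/

/-- Non-resonance for the spectrum of a vector field. -/
def NonResonantField {ν : ℕ} (lam : Fin ν → ℂ) : Prop :=
  ∀ (i : Fin ν) (m : Fin ν →₀ ℕ), 2 ≤ m.degree → lam i ≠ pairing m lam

/-- The numbers over which the minimum `Ω_{v.f.}(k)` is taken. -/
def smallDivisorsField {ν : ℕ} (lam : Fin ν → ℂ) (k : ℕ) : Set ℝ :=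
  {1} ∪ {x | ∃ (j : Fin ν) (m : Fin ν →₀ ℕ), 2 ≤ m.degree ∧ m.degree ≤ k + 1 ∧
    x = ‖pairing m lam - lam j‖}

/-- `Ω_{v.f.}(k)` for the spectrum `lam` of a vector field. -/
def OmegaField {ν : ℕ} (lam : Fin ν → ℂ) (k : ℕ) : ℝ := sInf (smallDivisorsField lam k)

/-- The Bruno series `B_{v.f.}(lam) = ∑_{k ≥ 1} (1/k - 1/(k+1)) log (1/Ω_{v.f.}(k))`, a series of
non-negative terms with value in `[0, ∞]` (the summation index is shifted by one). -/
def BrunoSeriesField {ν : ℕ} (lam : Fin ν → ℂ) : ENNReal :=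
  ∑' k : ℕ, ENNReal.ofReal
    ((1 / ((k : ℝ) + 1) - 1 / ((k : ℝ) + 2)) * Real.log (1 / OmegaField lam (k + 1)))

/-- `h` is a solution of the formal linearization problem for the formal vector field `V` with
linear part `V_lam`: it is tangent to the identity and
`∑_j lam_j z_j ∂h_i/∂z_j = V_i ∘ h` for all `i`. -/
def LinearizesField {ν : ℕ} (lam : Fin ν → ℂ) (V h : Tuple ν) : Prop :=
  h ∈ tangentToId ν ∧
    ∀ i, ∑ j, diagTuple lam j * MvPowerSeries.pderiv ℂ j (h i) = comp V h i

/-! ### The minima are attained, and `Ω(k)` does not depend on the choice of logarithms -/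

theorem finite_degree_le (ν N : ℕ) : {m : Fin ν →₀ ℕ | m.degree ≤ N}.Finite := by
  refine Set.Finite.subset (Set.finite_Iic (Finsupp.equivFunOnFinite.symm fun _ : Fin ν => N)) ?_
  intro m hm i
  exact (Finsupp.le_degree i m).trans hm

theorem smallDivisorsDiffeo_isLeast {ν : ℕ} (lam : Fin ν → ℂ) (k : ℕ) :
    IsLeast (smallDivisorsDiffeo lam k) (sInf (smallDivisorsDiffeo lam k)) := by
  have hfin : (smallDivisorsDiffeo lam k).Finite := by
    refine (Set.finite_singleton _).union ?_
    refine (((Set.finite_univ (α := Fin ν)).prod (finite_degree_le ν (k + 1))).image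
      fun p => distInt (pairing p.2 lam - lam p.1)).subset ?_
    rintro x ⟨j, m, -, h, rfl⟩
    exact ⟨(j, m), ⟨trivial, h⟩, rfl⟩
  have hne : (smallDivisorsDiffeo lam k).Nonempty := ⟨1, Or.inl rfl⟩
  exact ⟨hne.csInf_mem hfin, fun x hx => csInf_le hfin.bddBelow hx⟩

theorem smallDivisorsField_isLeast {ν : ℕ} (lam : Fin ν → ℂ) (k : ℕ) :
    IsLeast (smallDivisorsField lam k) (OmegaField lam k) := by
  have hfin : (smallDivisorsField lam k).Finite := by
    refine (Set.finite_singleton _).union ?_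
    refine (((Set.finite_univ (α := Fin ν)).prod (finite_degree_le ν (k + 1))).image
      fun p => ‖pairing p.2 lam - lam p.1‖).subset ?_
    rintro x ⟨j, m, -, h, rfl⟩
    exact ⟨(j, m), ⟨trivial, h⟩, rfl⟩
  have hne : (smallDivisorsField lam k).Nonempty := ⟨1, Or.inl rfl⟩
  exact ⟨hne.csInf_mem hfin, fun x hx => csInf_le hfin.bddBelow hx⟩

theorem distInt_add_int (w : ℂ) (n : ℤ) : distInt (w + n) = distInt w := by
  have key : ∀ (w : ℂ) (n : ℤ), distInt (w + n) ≤ distInt w := by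
    intro w n
    refine (Metric.le_infDist (Set.range_nonempty _)).2 fun y hy => ?_
    obtain ⟨p, rfl⟩ := hy
    have hmem : ((p + n : ℤ) : ℂ) ∈ Set.range ((↑) : ℤ → ℂ) := ⟨p + n, rfl⟩
    refine (Metric.infDist_le_dist_of_mem hmem).trans (le_of_eq ?_)
    rw [dist_eq_norm, dist_eq_norm]
    congr 1
    push_cast
    ring
  refine le_antisymm (key w n) ?_
  simpa using key (w + n) (-n)

theorem exp_exponents {ν : ℕ} {q : Fin ν → ℂ} (hq : ∀ j, q j ≠ 0) (j : Fin ν) :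
    Complex.exp (2 * Real.pi * Complex.I * exponents q j) = q j := by
  rw [exponents, mul_div_cancel₀ _ Complex.two_pi_I_ne_zero, Complex.exp_log (hq j)]

theorem OmegaDiffeo_eq {ν : ℕ} {q lam : Fin ν → ℂ}
    (h : ∀ j, Complex.exp (2 * Real.pi * Complex.I * lam j) = q j) (k : ℕ) :
    OmegaDiffeo q k = sInf (smallDivisorsDiffeo lam k) := by
  have hq : ∀ j, q j ≠ 0 := fun j => h j ▸ Complex.exp_ne_zero _
  have hn : ∀ j, ∃ n : ℤ, exponents q j = lam j + n := by
    intro j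
    obtain ⟨n, hn⟩ := Complex.exp_eq_exp_iff_exists_int.1 ((exp_exponents hq j).trans (h j).symm)
    refine ⟨n, mul_left_cancel₀ Complex.two_pi_I_ne_zero ?_⟩
    rw [hn]; ring
  choose n hn using hn
  have hd : ∀ (j : Fin ν) (m : Fin ν →₀ ℕ),
      distInt (pairing m (exponents q) - exponents q j) = distInt (pairing m lam - lam j) := by
    intro j m
    rw [← distInt_add_int (pairing m lam - lam j) (∑ i, (m i : ℤ) * n i - n j)]
    congr 1
    simp only [pairing, hn, mul_add, Finset.sum_add_distrib]
    push_cast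
    ring
  simp only [OmegaDiffeo, smallDivisorsDiffeo, hd]

end BrunoLin

end

noncomputable section

namespace BrunoLin

open MvPowerSeries

variable {ν : ℕ}

/-! ### Formal solution of the linearized equation -/

/-! Compared coefficient by coefficient, both conjugacy equations become `D i m * h_{i,m} = (a_i ∘
h)_m` for `|m| ≥ 2`, with `D i m = q^m / q_i - 1` or `m · lam - lam_i` (`linearizesDiffeo_iff`,
`linearizesField_iff`). Since `a` has order at least two, the right side up to degree `n + 1`
depends only on `h` up to degree `n`. Nonvanishing of `D` therefore gives exactly one formal
solution (`exists_solves`, `solves_unique`).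

Convergence is proved with a weighted `ℓ¹` norm, with weight `w m = exp (-U m) * r ^ |m|`. Suppose
that `U` is superadditive and satisfies `U (x + y) ≥ U x + U y - log |D i (x + y)|` for nonzero `x`,
`y`. Then `w` is submultiplicative, and stays so after division by `D` at sums of nonzero exponents.
Every monomial `h ^ d` with `|d| ≥ 2` is a product of two series without constant term, so the
divisors cost nothing and an induction on the truncation degree bounds the norm of `h` by `2 r`
(`truncNorm_solution_le`). The bound `U m ≤ C |m|` then gives a positive radius of convergence.

It remains to build `U` (`exists_superadditive`). For each scale `2^k` and index `j`, the exponents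
with divisor below `Ω(2^k)/2` have degree at least `2^k`, and comparable ones differ in degree by at
least `2^k`. Bruno's counting argument takes the form of a superadditive function that jumps by one
at each such exponent and is at most `2 |m| / 2^k`. Weighting it by `log (2 / Ω(2^(k+1)))` and
summing over `k` and `j` pays for all small divisors, and the dyadic form of the Bruno series makes
the sum linear in `|m|`. For diffeomorphisms, `half_min_distInt_le` compares `|q^m / q_i - 1|` with
the distance to the integers. -/

theorem exists_eq_single_add {d : Fin ν →₀ ℕ} (hd : d ≠ 0) :
    ∃ j d', d = Finsupp.single j 1 + d' := by
  obtain ⟨j, hj⟩ := Finsupp.ne_iff.1 hd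
  refine ⟨j, d - Finsupp.single j 1, ?_⟩
  rw [add_tsub_cancel_of_le]
  simpa [Finsupp.single_le_iff, Nat.one_le_iff_ne_zero] using hj

/-- The monomial `h ^ d` in the components of a tuple. -/
def tuplePow (h : Tuple ν) (d : Fin ν →₀ ℕ) : MvPowerSeries (Fin ν) ℂ := d.prod fun s e => h s ^ e

theorem tuplePow_zero (h : Tuple ν) : tuplePow h 0 = 1 := Finsupp.prod_zero_index

theorem tuplePow_single_add (h : Tuple ν) (j : Fin ν) (d : Fin ν →₀ ℕ) :
    tuplePow h (Finsupp.single j 1 + d) = h j * tuplePow h d := by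
  rw [tuplePow, Finsupp.prod_add_index' (fun _ => pow_zero _) (fun _ _ _ => pow_add _ _ _),
    Finsupp.prod_single_index (h := fun s e => h s ^ e) (pow_zero _), pow_one, tuplePow]

theorem constantCoeff_tuplePow {h : Tuple ν} (hh : ∀ i, constantCoeff (h i) = 0)
    {d : Fin ν →₀ ℕ} (hd : d ≠ 0) : constantCoeff (tuplePow h d) = 0 := by
  obtain ⟨j, d, rfl⟩ := exists_eq_single_add hd
  rw [tuplePow_single_add, map_mul, hh, zero_mul]

/-- Induction on a multi-exponent by adding one unit at a time. -/
theorem exponent_induction {P : (Fin ν →₀ ℕ) → Prop} (zero : P 0)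
    (step : ∀ j d, P d → P (Finsupp.single j 1 + d)) (d : Fin ν →₀ ℕ) : P d := by
  generalize hn : d.degree = n
  induction n generalizing d with
  | zero => rwa [(Finsupp.degree_eq_zero_iff d).1 hn]
  | succ n ih =>
    have hd : d ≠ 0 := by rintro rfl; simp at hn
    obtain ⟨j, d, rfl⟩ := exists_eq_single_add hd
    refine step j d (ih d ?_)
    rw [map_add, Finsupp.degree_single] at hn
    omega

theorem coeff_tuplePow_of_lt {h : Tuple ν} (hh : ∀ i, constantCoeff (h i) = 0)
    (d m : Fin ν →₀ ℕ) (hm : m.degree < d.degree) : coeff m (tuplePow h d) = 0 := by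
  classical
  induction d using exponent_induction generalizing m with
  | zero => simp at hm
  | step j d ih =>
    rw [tuplePow_single_add, coeff_mul]
    refine Finset.sum_eq_zero fun x hx => ?_
    rw [Finset.HasAntidiagonal.mem_antidiagonal] at hx
    by_cases h0 : x.1 = 0
    · rw [h0, coeff_zero_eq_constantCoeff_apply, hh, zero_mul]
    · rw [ih x.2, mul_zero]
      have h1 : x.1.degree ≠ 0 := fun h => h0 ((Finsupp.degree_eq_zero_iff _).1 h)
      have h2 : x.1.degree + x.2.degree = m.degree := by rw [← map_add, hx]
      rw [map_add, Finsupp.degree_single] at hm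
      omega

/-- Two series agree up to total degree `n`. -/
def AgreeUpTo (n : ℕ) (p q : MvPowerSeries (Fin ν) ℂ) : Prop :=
  ∀ m : Fin ν →₀ ℕ, m.degree ≤ n → coeff m p = coeff m q

theorem AgreeUpTo.trans {n : ℕ} {p q r : MvPowerSeries (Fin ν) ℂ} (h : AgreeUpTo n p q)
    (h' : AgreeUpTo n q r) : AgreeUpTo n p r := fun m hm => (h m hm).trans (h' m hm)

theorem AgreeUpTo.mono {n k : ℕ} {p q : MvPowerSeries (Fin ν) ℂ} (h : AgreeUpTo n p q)
    (hk : k ≤ n) : AgreeUpTo k p q := fun m hm => h m (hm.trans hk)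

theorem AgreeUpTo.mul {n : ℕ} {p p' q q' : MvPowerSeries (Fin ν) ℂ} (hp : AgreeUpTo n p p')
    (hq : AgreeUpTo n q q') : AgreeUpTo n (p * q) (p' * q') := by
  classical
  intro m hm
  rw [coeff_mul, coeff_mul]
  refine Finset.sum_congr rfl fun x hx => ?_
  rw [Finset.HasAntidiagonal.mem_antidiagonal] at hx
  have h2 : x.1.degree + x.2.degree = m.degree := by rw [← map_add, hx]
  rw [hp x.1 (by omega), hq x.2 (by omega)]

/-- Without constant terms, a coefficient of degree `n + 1` of the product only involves factors of
degree at most `n`. This gain of one degree makes the formal recursion solvable. -/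
theorem AgreeUpTo.mul_succ {n : ℕ} {p p' q q' : MvPowerSeries (Fin ν) ℂ} (hp : AgreeUpTo n p p')
    (hq : AgreeUpTo n q q') (hp0 : constantCoeff p = 0) (hp0' : constantCoeff p' = 0)
    (hq0 : constantCoeff q = 0) (hq0' : constantCoeff q' = 0) :
    AgreeUpTo (n + 1) (p * q) (p' * q') := by
  classical
  intro m hm
  rw [coeff_mul, coeff_mul]
  refine Finset.sum_congr rfl fun x hx => ?_
  rw [Finset.HasAntidiagonal.mem_antidiagonal] at hx
  have h2 : x.1.degree + x.2.degree = m.degree := by rw [← map_add, hx]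
  by_cases h0 : x.1 = 0
  · rw [h0]; simp [hp0, hp0']
  by_cases h1 : x.2 = 0
  · rw [h1]; simp [hq0, hq0']
  have h0' : x.1.degree ≠ 0 := fun h => h0 ((Finsupp.degree_eq_zero_iff _).1 h)
  have h1' : x.2.degree ≠ 0 := fun h => h1 ((Finsupp.degree_eq_zero_iff _).1 h)
  rw [hp x.1 (by omega), hq x.2 (by omega)]

theorem AgreeUpTo.tuplePow {n : ℕ} {h h' : Tuple ν} (hh : ∀ i, AgreeUpTo n (h i) (h' i))
    (d : Fin ν →₀ ℕ) : AgreeUpTo n (tuplePow h d) (BrunoLin.tuplePow h' d) := by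
  induction d using exponent_induction with
  | zero => intro m _; rw [tuplePow_zero, tuplePow_zero]
  | step j d ih =>
    rw [tuplePow_single_add, tuplePow_single_add]
    exact (hh j).mul ih

theorem AgreeUpTo.subst {n : ℕ} {h h' : Tuple ν} (hh : ∀ i, AgreeUpTo n (h i) (h' i))
    (h0 : ∀ i, constantCoeff (h i) = 0) (h0' : ∀ i, constantCoeff (h' i) = 0)
    {f : MvPowerSeries (Fin ν) ℂ} (hf : ∀ m : Fin ν →₀ ℕ, m.degree ≤ 1 → coeff m f = 0) :
    AgreeUpTo (n + 1) (subst h f) (MvPowerSeries.subst h' f) := by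
  intro m hm
  rw [coeff_subst (hasSubst_of_constantCoeff_zero h0),
    coeff_subst (hasSubst_of_constantCoeff_zero h0')]
  refine finsum_congr fun d => ?_
  by_cases hd : d.degree ≤ 1
  · rw [hf d hd, zero_smul, zero_smul]
  congr 1
  change coeff m (BrunoLin.tuplePow h d) = coeff m (BrunoLin.tuplePow h' d)
  obtain ⟨j, d, rfl⟩ := exists_eq_single_add (d := d) (by rintro rfl; simp at hd)
  have hd0 : d ≠ 0 := by rintro rfl; simp at hd
  rw [tuplePow_single_add, tuplePow_single_add]
  exact (hh j).mul_succ (AgreeUpTo.tuplePow hh d) (h0 j) (h0' j) (constantCoeff_tuplePow h0 hd0)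
    (constantCoeff_tuplePow h0' hd0) m hm

theorem coeff_subst_of_degree_le_one {h : Tuple ν} (h0 : ∀ i, constantCoeff (h i) = 0)
    {f : MvPowerSeries (Fin ν) ℂ} (hf : ∀ m : Fin ν →₀ ℕ, m.degree ≤ 1 → coeff m f = 0)
    {m : Fin ν →₀ ℕ} (hm : m.degree ≤ 1) : coeff m (subst h f) = 0 := by
  -- A tuple without constant terms agrees in degree 0 with the zero tuple, so one degree is gained
  -- by comparison with it.
  have key : AgreeUpTo (0 + 1) (subst h f) (subst (0 : Tuple ν) f) := by
    refine AgreeUpTo.subst (fun i k hk => ?_) h0 (fun i => by simp) hf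
    rw [Nat.le_zero, Finsupp.degree_eq_zero_iff] at hk
    rw [hk]
    simp [h0]
  have hf0 : constantCoeff f = 0 := by
    rw [← coeff_zero_eq_constantCoeff_apply]; exact hf 0 (by simp)
  rw [key m hm, subst_zero_of_constantCoeff_zero hf0, coeff_zero]

theorem mem_tangentToId_iff {h : Tuple ν} :
    h ∈ tangentToId ν ↔
      ∀ i (m : Fin ν →₀ ℕ), m.degree ≤ 1 → coeff m (h i) = coeff m (X i) := by
  simp only [tangentToId, nonlinearTuples, Set.mem_ofPred_eq, Pi.sub_apply, map_sub, sub_eq_zero,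
    idTuple]

theorem constantCoeff_of_mem_tangentToId {h : Tuple ν} (hh : h ∈ tangentToId ν) (i : Fin ν) :
    constantCoeff (h i) = 0 := by
  rw [← coeff_zero_eq_constantCoeff_apply, mem_tangentToId_iff.1 hh i 0 (by simp), coeff_zero_X]

/-- `h` is tangent to the identity and solves `D_{i,m} h_{i,m} = (f_i ∘ h)_m` for `|m| ≥ 2`. -/
def Solves (D : Fin ν → (Fin ν →₀ ℕ) → ℂ) (f h : Tuple ν) : Prop :=
  h ∈ tangentToId ν ∧
    ∀ i (m : Fin ν →₀ ℕ), 2 ≤ m.degree → D i m * coeff m (h i) = coeff m (comp f h i)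

/-- The map whose fixed points are the solutions in the sense of `Solves`. -/
def solveStep (D : Fin ν → (Fin ν →₀ ℕ) → ℂ) (f h : Tuple ν) : Tuple ν := fun i m =>
  if m.degree ≤ 1 then coeff m (X i : MvPowerSeries (Fin ν) ℂ) else coeff m (comp f h i) / D i m

theorem coeff_solveStep (D : Fin ν → (Fin ν →₀ ℕ) → ℂ) (f h : Tuple ν) (i : Fin ν)
    (m : Fin ν →₀ ℕ) : coeff m (solveStep D f h i) =
      if m.degree ≤ 1 then coeff m (X i : MvPowerSeries (Fin ν) ℂ)
      else coeff m (comp f h i) / D i m := rfl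

theorem solveStep_mem_tangentToId (D : Fin ν → (Fin ν →₀ ℕ) → ℂ) (f h : Tuple ν) :
    solveStep D f h ∈ tangentToId ν :=
  mem_tangentToId_iff.2 fun i m hm => by rw [coeff_solveStep, if_pos hm]

theorem solves_iff_solveStep_eq {D : Fin ν → (Fin ν →₀ ℕ) → ℂ} {f h : Tuple ν}
    (hD : ∀ i (m : Fin ν →₀ ℕ), 2 ≤ m.degree → D i m ≠ 0) :
    Solves D f h ↔ solveStep D f h = h := by
  constructor
  · rintro ⟨h1, h2⟩
    funext i
    ext m
    rw [coeff_solveStep]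
    split_ifs with hm
    · exact (mem_tangentToId_iff.1 h1 i m hm).symm
    · have hm : 2 ≤ m.degree := by omega
      rw [← h2 i m hm, mul_div_cancel_left₀ _ (hD i m hm)]
  · intro e
    refine ⟨e ▸ solveStep_mem_tangentToId D f h, fun i m hm => ?_⟩
    have := coeff_solveStep D f h i m
    rw [e, if_neg (by omega)] at this
    rw [this, mul_div_cancel₀ _ (hD i m hm)]

theorem solveStep_agree (D : Fin ν → (Fin ν →₀ ℕ) → ℂ) {f h h' : Tuple ν}
    (hf : f ∈ nonlinearTuples ν) (hh : h ∈ tangentToId ν) (hh' : h' ∈ tangentToId ν) {n : ℕ}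
    (H : ∀ i, AgreeUpTo n (h i) (h' i)) (i : Fin ν) :
    AgreeUpTo (n + 1) (solveStep D f h i) (solveStep D f h' i) := by
  intro m hm
  rw [coeff_solveStep, coeff_solveStep, comp, comp,
    AgreeUpTo.subst H (constantCoeff_of_mem_tangentToId hh) (constantCoeff_of_mem_tangentToId hh')
      (hf i) m hm]

theorem solves_unique {D : Fin ν → (Fin ν →₀ ℕ) → ℂ} {f h h' : Tuple ν}
    (hD : ∀ i (m : Fin ν →₀ ℕ), 2 ≤ m.degree → D i m ≠ 0) (hf : f ∈ nonlinearTuples ν)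
    (hh : Solves D f h) (hh' : Solves D f h') : h' = h := by
  have key : ∀ n i, AgreeUpTo n (h' i) (h i) := by
    intro n
    induction n with
    | zero =>
      intro i m hm
      rw [mem_tangentToId_iff.1 hh.1 i m (by omega), mem_tangentToId_iff.1 hh'.1 i m (by omega)]
    | succ n ih =>
      rw [← (solves_iff_solveStep_eq hD).1 hh, ← (solves_iff_solveStep_eq hD).1 hh']
      exact solveStep_agree D hf hh'.1 hh.1 ih
  funext i
  ext m
  exact key _ i m le_rfl

theorem exists_solves {D : Fin ν → (Fin ν →₀ ℕ) → ℂ} {f : Tuple ν}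
    (hD : ∀ i (m : Fin ν →₀ ℕ), 2 ≤ m.degree → D i m ≠ 0) (hf : f ∈ nonlinearTuples ν) :
    ∃ h, Solves D f h := by
  obtain ⟨H, hzero, hsucc⟩ : ∃ H : ℕ → Tuple ν, H 0 = idTuple ν ∧
      ∀ n, H (n + 1) = solveStep D f (H n) :=
    ⟨fun n => (solveStep D f)^[n] (idTuple ν), rfl, fun n => Function.iterate_succ_apply' _ _ _⟩
  have htan : ∀ n, H n ∈ tangentToId ν := by
    intro n
    cases n with
    | zero => rw [hzero]; exact mem_tangentToId_iff.2 fun i m _ => rfl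
    | succ n => rw [hsucc]; exact solveStep_mem_tangentToId D f _
  have hstep : ∀ n i, AgreeUpTo (n + 1) (H (n + 1) i) (H n i) := by
    intro n
    induction n with
    | zero =>
      intro i m hm
      rw [mem_tangentToId_iff.1 (htan 0) i m hm, mem_tangentToId_iff.1 (htan 1) i m hm]
    | succ n ih =>
      intro i
      have := solveStep_agree D hf (htan _) (htan _) ih i
      rwa [← hsucc, ← hsucc] at this
  have hle : ∀ k n, k ≤ n → ∀ i, AgreeUpTo k (H n i) (H k i) := by
    intro k n hkn i
    induction n, hkn using Nat.le_induction with
    | base => exact fun m _ => rfl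
    | succ n hkn ih => exact ((hstep n i).mono (by omega)).trans ih
  -- The coefficient at `m` no longer changes from the iterate of index `|m|` on, so this is the
  -- limit of the iterates.
  let h : Tuple ν := fun i m => coeff m (H m.degree i)
  have hH : ∀ n i, AgreeUpTo n (h i) (H n i) := fun n i m hm => (hle m.degree n hm i m le_rfl).symm
  have hh : h ∈ tangentToId ν := mem_tangentToId_iff.2 fun i m hm =>
    (hH 1 i m hm).trans (mem_tangentToId_iff.1 (htan 1) i m hm)
  refine ⟨h, (solves_iff_solveStep_eq hD).2 ?_⟩
  funext i
  ext m
  have h1 := solveStep_agree D hf hh (htan m.degree) (hH m.degree) i m (by omega)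
  rw [h1, ← hsucc]
  exact (hH (m.degree + 1) i m (by omega)).symm

/-! ### Weighted majorant estimates -/

/-- The finite set of exponents of total degree at most `N`. -/
def degreeBall (ν N : ℕ) : Finset (Fin ν →₀ ℕ) := (finite_degree_le ν N).toFinset

theorem mem_degreeBall {N : ℕ} {m : Fin ν →₀ ℕ} : m ∈ degreeBall ν N ↔ m.degree ≤ N := by
  simp [degreeBall]

/-- The truncated weighted `ℓ¹`-norm of a series. -/
def truncNorm (w : (Fin ν →₀ ℕ) → ℝ) (N : ℕ) (p : MvPowerSeries (Fin ν) ℂ) : ℝ :=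
  ∑ m ∈ degreeBall ν N, ‖coeff m p‖ * w m

theorem truncNorm_nonneg {w : (Fin ν →₀ ℕ) → ℝ} (hw : ∀ m, 0 ≤ w m) (N : ℕ)
    (p : MvPowerSeries (Fin ν) ℂ) : 0 ≤ truncNorm w N p :=
  Finset.sum_nonneg fun m _ => mul_nonneg (norm_nonneg _) (hw m)

/-- `H` is required only where both coefficients are nonzero. For factors without constant term this
permits `M = N + 1`, and a weight inequality that holds only for nonzero exponents. -/
theorem truncNorm_mul_le {w v : (Fin ν →₀ ℕ) → ℝ} (hw : ∀ m, 0 ≤ w m) (hv : ∀ m, 0 ≤ v m)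
    {N M : ℕ} {p q : MvPowerSeries (Fin ν) ℂ}
    (H : ∀ x y : Fin ν →₀ ℕ, x.degree + y.degree ≤ M → coeff x p ≠ 0 → coeff y q ≠ 0 →
      x.degree ≤ N ∧ y.degree ≤ N ∧ v (x + y) ≤ w x * w y) :
    truncNorm v M (p * q) ≤ truncNorm w N p * truncNorm w N q := by
  classical
  set g : (Fin ν →₀ ℕ) × (Fin ν →₀ ℕ) → ℝ :=
    fun x => (‖coeff x.1 p‖ * w x.1) * (‖coeff x.2 q‖ * w x.2) with hg
  have hg0 : ∀ x, 0 ≤ g x := fun x =>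
    mul_nonneg (mul_nonneg (norm_nonneg _) (hw _)) (mul_nonneg (norm_nonneg _) (hw _))
  have hterm : ∀ m ∈ degreeBall ν M, ‖coeff m (p * q)‖ * v m ≤
      ∑ x ∈ degreeBall ν N ×ˢ degreeBall ν N with x.1 + x.2 = m, g x := by
    intro m hm
    rw [mem_degreeBall] at hm
    have h1 : ‖coeff m (p * q)‖ * v m ≤
        ∑ x ∈ Finset.HasAntidiagonal.antidiagonal m, ‖coeff x.1 p‖ * ‖coeff x.2 q‖ * v m := by
      rw [coeff_mul, ← Finset.sum_mul]
      refine mul_le_mul_of_nonneg_right ((norm_sum_le _ _).trans ?_) (hv m)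
      exact Finset.sum_le_sum fun x _ => (norm_mul _ _).le
    refine h1.trans ?_
    have h2 : ∀ x ∈ Finset.HasAntidiagonal.antidiagonal m, ‖coeff x.1 p‖ * ‖coeff x.2 q‖ * v m ≤
        if x ∈ (degreeBall ν N ×ˢ degreeBall ν N).filter (fun x => x.1 + x.2 = m)
          then g x else 0 := by
      intro x hx
      rw [Finset.HasAntidiagonal.mem_antidiagonal] at hx
      have hdeg : x.1.degree + x.2.degree = m.degree := by rw [← map_add, hx]
      have hif : (0 : ℝ) ≤ if x ∈ (degreeBall ν N ×ˢ degreeBall ν N).filter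
          (fun x => x.1 + x.2 = m) then g x else 0 := by
        split_ifs
        exacts [hg0 x, le_rfl]
      by_cases hp : coeff x.1 p = 0
      · simpa only [hp, norm_zero, zero_mul] using hif
      by_cases hq : coeff x.2 q = 0
      · simpa only [hq, norm_zero, zero_mul, mul_zero] using hif
      obtain ⟨ha, hb, hc⟩ := H x.1 x.2 (by omega) hp hq
      rw [if_pos (by simp [mem_degreeBall, ha, hb, hx])]
      rw [hx] at hc
      calc ‖coeff x.1 p‖ * ‖coeff x.2 q‖ * v m
          ≤ ‖coeff x.1 p‖ * ‖coeff x.2 q‖ * (w x.1 * w x.2) := by gcongr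
        _ = g x := by rw [hg]; ring
    refine (Finset.sum_le_sum h2).trans ?_
    rw [← Finset.sum_filter]
    refine Finset.sum_le_sum_of_subset_of_nonneg ?_ fun x _ _ => hg0 x
    intro x hx
    exact (Finset.mem_filter.1 hx).2
  calc truncNorm v M (p * q)
      ≤ ∑ m ∈ degreeBall ν M,
          ∑ x ∈ degreeBall ν N ×ˢ degreeBall ν N with x.1 + x.2 = m, g x :=
        Finset.sum_le_sum hterm
    _ ≤ ∑ x ∈ degreeBall ν N ×ˢ degreeBall ν N, g x :=
        Finset.sum_fiberwise_le_sum_of_sum_fiber_nonneg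
          fun _ _ => Finset.sum_nonneg fun x _ => hg0 x
    _ = truncNorm w N p * truncNorm w N q := by
        rw [Finset.sum_product, truncNorm, truncNorm, Finset.sum_mul_sum]

theorem truncNorm_tuplePow_le {w : (Fin ν →₀ ℕ) → ℝ} (hw : ∀ m, 0 ≤ w m) (hw0 : w 0 ≤ 1)
    (hmul : ∀ x y, w (x + y) ≤ w x * w y) {N : ℕ} {R : ℝ} {h : Tuple ν}
    (hR : ∀ i, truncNorm w N (h i) ≤ R) (d : Fin ν →₀ ℕ) :
    truncNorm w N (tuplePow h d) ≤ R ^ d.degree := by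
  classical
  induction d using exponent_induction with
  | zero =>
    rw [tuplePow_zero, truncNorm, map_zero, pow_zero,
      Finset.sum_eq_single_of_mem 0 (mem_degreeBall.2 (by simp)), coeff_zero_one, norm_one, one_mul]
    · exact hw0
    · intro m _ hm
      rw [coeff_one, if_neg hm, norm_zero, zero_mul]
  | step j d ih =>
    rw [tuplePow_single_add, map_add, Finsupp.degree_single, pow_add, pow_one]
    refine (truncNorm_mul_le hw hw (N := N) fun x y hxy _ _ =>
      ⟨by omega, by omega, hmul x y⟩).trans ?_
    exact mul_le_mul (hR j) ih (truncNorm_nonneg hw _ _) ((truncNorm_nonneg hw _ _).trans (hR j))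

/-- Bound for monomials of degree at least two, with the small divisor included in the weight. -/
theorem truncNorm_tuplePow_succ_le {w v : (Fin ν →₀ ℕ) → ℝ} (hw : ∀ m, 0 ≤ w m)
    (hv : ∀ m, 0 ≤ v m) (hw0 : w 0 ≤ 1) (hmul : ∀ x y, w (x + y) ≤ w x * w y)
    (hvw : ∀ x y, x ≠ 0 → y ≠ 0 → v (x + y) ≤ w x * w y) {N : ℕ} {R : ℝ} {h : Tuple ν}
    (h0 : ∀ i, constantCoeff (h i) = 0) (hR : ∀ i, truncNorm w N (h i) ≤ R)
    {d : Fin ν →₀ ℕ} (hd : 2 ≤ d.degree) :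
    truncNorm v (N + 1) (tuplePow h d) ≤ R ^ d.degree := by
  obtain ⟨j, d, rfl⟩ := exists_eq_single_add (d := d) (by rintro rfl; simp at hd)
  have hd0 : d ≠ 0 := by rintro rfl; simp at hd
  rw [tuplePow_single_add, map_add, Finsupp.degree_single, pow_add, pow_one]
  refine (truncNorm_mul_le hw hv (N := N) fun x y hxy hx hy => ?_).trans
    (mul_le_mul (hR j) (truncNorm_tuplePow_le hw hw0 hmul hR d) (truncNorm_nonneg hw _ _)
      ((truncNorm_nonneg hw _ _).trans (hR j)))
  have hx0 : x ≠ 0 := by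
    rintro rfl
    exact hx (by rw [coeff_zero_eq_constantCoeff_apply, h0])
  have hy0 : y ≠ 0 := by
    rintro rfl
    exact hy (by rw [coeff_zero_eq_constantCoeff_apply, constantCoeff_tuplePow h0 hd0])
  have hx1 : x.degree ≠ 0 := fun e => hx0 ((Finsupp.degree_eq_zero_iff _).1 e)
  have hy1 : y.degree ≠ 0 := fun e => hy0 ((Finsupp.degree_eq_zero_iff _).1 e)
  exact ⟨by omega, by omega, hvw x y hx0 hy0⟩

theorem norm_coeff_subst_le {h : Tuple ν} (h0 : ∀ i, constantCoeff (h i) = 0)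
    (f : MvPowerSeries (Fin ν) ℂ) {N : ℕ} {m : Fin ν →₀ ℕ} (hm : m.degree ≤ N) :
    ‖coeff m (subst h f)‖ ≤ ∑ d ∈ degreeBall ν N, ‖coeff d f‖ * ‖coeff m (tuplePow h d)‖ := by
  rw [coeff_subst (hasSubst_of_constantCoeff_zero h0)]
  -- The sum is finite because `h ^ d` has no terms of degree below `|d|`.
  rw [finsum_eq_sum_of_support_subset (s := degreeBall ν N)]
  · refine (norm_sum_le _ _).trans (Finset.sum_le_sum fun d _ => ?_)
    rw [norm_smul, tuplePow]
  · intro d hd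
    rw [Finset.mem_coe, mem_degreeBall]
    by_contra hlt
    refine hd ?_
    change coeff d f • coeff m (tuplePow h d) = 0
    rw [coeff_tuplePow_of_lt h0 d m (by omega), smul_zero]

theorem truncNorm_subst_le {w v : (Fin ν →₀ ℕ) → ℝ} (hw : ∀ m, 0 ≤ w m)
    (hv : ∀ m, 0 ≤ v m) (hw0 : w 0 ≤ 1) (hmul : ∀ x y, w (x + y) ≤ w x * w y)
    (hvw : ∀ x y, x ≠ 0 → y ≠ 0 → v (x + y) ≤ w x * w y) {N : ℕ} {R : ℝ} {h : Tuple ν}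
    (h0 : ∀ i, constantCoeff (h i) = 0) (hR : ∀ i, truncNorm w N (h i) ≤ R)
    {f : MvPowerSeries (Fin ν) ℂ} (hf : ∀ m : Fin ν →₀ ℕ, m.degree ≤ 1 → coeff m f = 0) :
    truncNorm v (N + 1) (subst h f) ≤ truncNorm (fun d => R ^ d.degree) (N + 1) f := by
  calc truncNorm v (N + 1) (subst h f)
      ≤ ∑ m ∈ degreeBall ν (N + 1), ∑ d ∈ degreeBall ν (N + 1),
          ‖coeff d f‖ * (‖coeff m (tuplePow h d)‖ * v m) := by
        refine Finset.sum_le_sum fun m hm => ?_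
        simp only [← mul_assoc]
        rw [← Finset.sum_mul]
        exact mul_le_mul_of_nonneg_right (norm_coeff_subst_le h0 f (mem_degreeBall.1 hm)) (hv m)
    _ = ∑ d ∈ degreeBall ν (N + 1), ‖coeff d f‖ * truncNorm v (N + 1) (tuplePow h d) := by
        rw [Finset.sum_comm]
        simp only [truncNorm, Finset.mul_sum]
    _ ≤ truncNorm (fun d => R ^ d.degree) (N + 1) f := by
        refine Finset.sum_le_sum fun d _ => ?_
        by_cases hd : d.degree ≤ 1
        · rw [hf d hd, norm_zero, zero_mul, zero_mul]
        · exact mul_le_mul_of_nonneg_left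
            (truncNorm_tuplePow_succ_le hw hv hw0 hmul hvw h0 hR (by omega)) (norm_nonneg _)

/-- Bootstrap on `N`: if the bound `2 r` holds up to degree `N`, the nonlinear part up to degree `N
+ 1` is majorized by `f` at radius `2 r`, hence by `r`, and the linear term contributes at most
another `r`. -/
theorem truncNorm_solution_le {D : Fin ν → (Fin ν →₀ ℕ) → ℂ} {f h : Tuple ν}
    (hD : ∀ i (m : Fin ν →₀ ℕ), 2 ≤ m.degree → D i m ≠ 0) (hf : f ∈ nonlinearTuples ν)
    (hh : Solves D f h) {w : (Fin ν →₀ ℕ) → ℝ} (hw : ∀ m, 0 ≤ w m) (hw0 : w 0 ≤ 1)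
    (hmul : ∀ x y, w (x + y) ≤ w x * w y)
    (hvw : ∀ i x y, x ≠ 0 → y ≠ 0 → w (x + y) / ‖D i (x + y)‖ ≤ w x * w y) {r : ℝ}
    (hr : 0 ≤ r) (hwr : ∀ i, w (Finsupp.single i 1) ≤ r)
    (hfr : ∀ i N, truncNorm (fun d => (2 * r) ^ d.degree) N (f i) ≤ r) (N : ℕ) (i : Fin ν) :
    truncNorm w N (h i) ≤ 2 * r := by
  classical
  have h0 := constantCoeff_of_mem_tangentToId hh.1
  induction N generalizing i with
  | zero =>
    refine (Finset.sum_nonpos fun m hm => ?_).trans (by positivity)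
    rw [mem_degreeBall, Nat.le_zero, Finsupp.degree_eq_zero_iff] at hm
    rw [hm, coeff_zero_eq_constantCoeff_apply, h0, norm_zero, zero_mul]
  | succ N ih =>
    have hv : ∀ m, 0 ≤ w m / ‖D i m‖ := fun m => div_nonneg (hw m) (norm_nonneg _)
    have h1 := truncNorm_subst_le hw hv hw0 hmul (hvw i) h0 ih (hf i)
    have h2 : truncNorm w (N + 1) (X i) ≤ r := by
      rw [truncNorm, Finset.sum_eq_single_of_mem (Finsupp.single i 1)
        (mem_degreeBall.2 (by simp)), coeff_index_single_self_X, norm_one, one_mul]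
      · exact hwr i
      · intro m _ hm
        rw [coeff_X, if_neg hm, norm_zero, zero_mul]
    have h3 : truncNorm w (N + 1) (h i) ≤ truncNorm w (N + 1) (X i) +
        truncNorm (fun m => w m / ‖D i m‖) (N + 1) (subst h (f i)) := by
      rw [truncNorm, truncNorm, truncNorm, ← Finset.sum_add_distrib]
      refine Finset.sum_le_sum fun m _ => ?_
      by_cases hm : m.degree ≤ 1
      · rw [mem_tangentToId_iff.1 hh.1 i m hm]
        exact le_add_of_nonneg_right (mul_nonneg (norm_nonneg _) (hv m))
      · have hm2 : 2 ≤ m.degree := by omega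
        have hDm := norm_pos_iff.2 (hD i m hm2)
        refine le_add_of_nonneg_of_le (mul_nonneg (norm_nonneg _) (hw m)) (le_of_eq ?_)
        have := hh.2 i m hm2
        rw [comp] at this
        rw [← this, norm_mul]
        field_simp
    linarith [hfr i (N + 1)]

theorem summable_of_truncNorm_le {w : (Fin ν →₀ ℕ) → ℝ} (hw : ∀ m, 0 ≤ w m)
    {p : MvPowerSeries (Fin ν) ℂ} {B : ℝ} (hB : ∀ N, truncNorm w N p ≤ B) :
    Summable fun m => ‖coeff m p‖ * w m := by
  refine summable_of_sum_le (fun m => mul_nonneg (norm_nonneg _) (hw m)) (c := B) fun s => ?_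
  refine (Finset.sum_le_sum_of_subset_of_nonneg (t := degreeBall ν (s.sup Finsupp.degree))
    (fun m hm => ?_) fun m _ _ => mul_nonneg (norm_nonneg _) (hw m)).trans (hB _)
  exact mem_degreeBall.2 (Finset.le_sup (f := Finsupp.degree) hm)

/-- For a convergent nonlinear series the majorant at radius `2 r` is at most `r`. -/
theorem SeriesConvergent.exists_truncNorm_le {f : MvPowerSeries (Fin ν) ℂ}
    (hf : ∀ m : Fin ν →₀ ℕ, m.degree ≤ 1 → coeff m f = 0) (hc : SeriesConvergent f) :
    ∃ r₀ : ℝ, 0 < r₀ ∧ ∀ r, 0 ≤ r → r ≤ r₀ →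
      ∀ N, truncNorm (fun d => (2 * r) ^ d.degree) N f ≤ r := by
  obtain ⟨ρ, hρ, hs⟩ := hc
  set A := ∑' m : Fin ν →₀ ℕ, ‖coeff m f‖ * ρ ^ m.degree with hA
  have hA0 : 0 ≤ A := tsum_nonneg fun m => by positivity
  -- The first bound gives `2 r / ρ ≤ 1`, so order at least two bounds the majorant by `(2 r / ρ)²
  -- A`; the second makes this at most `r`. The `+ 1` covers `A = 0`.
  refine ⟨min (ρ / 2) (ρ ^ 2 / (4 * (A + 1))), by positivity, fun r hr hr₀ N => ?_⟩
  have hr1 : 2 * r / ρ ≤ 1 := by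
    rw [div_le_one hρ]
    linarith [hr₀.trans (min_le_left _ _)]
  have hr2 : r * (4 * (A + 1)) ≤ ρ ^ 2 := by
    rw [← le_div_iff₀ (by positivity)]
    exact hr₀.trans (min_le_right _ _)
  calc truncNorm (fun d => (2 * r) ^ d.degree) N f
      ≤ ∑ m ∈ degreeBall ν N, (2 * r / ρ) ^ 2 * (‖coeff m f‖ * ρ ^ m.degree) := by
        refine Finset.sum_le_sum fun m _ => ?_
        by_cases hm : m.degree ≤ 1
        · rw [hf m hm]; simp
        have h1 : (2 * r / ρ) ^ m.degree ≤ (2 * r / ρ) ^ 2 :=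
          pow_le_pow_of_le_one (by positivity) hr1 (by omega)
        have h2 : (2 * r) ^ m.degree = (2 * r / ρ) ^ m.degree * ρ ^ m.degree := by
          rw [← mul_pow, div_mul_cancel₀ _ hρ.ne']
        beta_reduce
        rw [h2]
        calc ‖coeff m f‖ * ((2 * r / ρ) ^ m.degree * ρ ^ m.degree)
            ≤ ‖coeff m f‖ * ((2 * r / ρ) ^ 2 * ρ ^ m.degree) := by gcongr
          _ = _ := by ring
    _ ≤ (2 * r / ρ) ^ 2 * A := by
        rw [← Finset.mul_sum]
        exact mul_le_mul_of_nonneg_left (hs.sum_le_tsum _ fun m _ => by positivity)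
          (by positivity)
    _ ≤ r := by
        rw [div_pow, div_mul_eq_mul_div, div_le_iff₀ (by positivity)]
        nlinarith [mul_le_mul_of_nonneg_left hr2 hr, mul_nonneg hr hr]

/-- A solution converges as soon as the small divisors are absorbed by an exponentially bounded
superadditive function `U`. -/
theorem Solves.convergent {D : Fin ν → (Fin ν →₀ ℕ) → ℂ} {f h : Tuple ν}
    (hD : ∀ i (m : Fin ν →₀ ℕ), 2 ≤ m.degree → D i m ≠ 0) (hf : f ∈ nonlinearTuples ν)
    (hfc : Convergent f) (hh : Solves D f h) {U : (Fin ν →₀ ℕ) → ℝ} {C : ℝ}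
    (hU0 : ∀ m, 0 ≤ U m) (hUC : ∀ m, U m ≤ C * m.degree)
    (hUadd : ∀ x y, U x + U y ≤ U (x + y))
    (hUD : ∀ i x y, x ≠ 0 → y ≠ 0 → -Real.log ‖D i (x + y)‖ + (U x + U y) ≤ U (x + y)) :
    Convergent h := by
  choose r₀ hr₀ hbd using fun i => (hfc i).exists_truncNorm_le (hf i)
  obtain ⟨r, hr, hrr⟩ : ∃ r : ℝ, 0 < r ∧ ∀ i, r ≤ r₀ i := by
    rcases isEmpty_or_nonempty (Fin ν) with he | hne
    · exact ⟨1, one_pos, fun i => he.elim i⟩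
    · obtain ⟨i, hi⟩ := Finite.exists_min r₀
      exact ⟨r₀ i, hr₀ i, hi⟩
  set w : (Fin ν →₀ ℕ) → ℝ := fun m => Real.exp (-U m) * r ^ m.degree with hwdef
  have hw : ∀ m, 0 ≤ w m := fun m => by positivity
  have hU00 : U 0 = 0 := le_antisymm (by simpa using hUC 0) (hU0 0)
  have hw0 : w 0 ≤ 1 := by simp [hwdef, hU00]
  have hprod : ∀ x y, w x * w y = Real.exp (-(U x + U y)) * r ^ (x + y).degree := by
    intro x y
    rw [map_add, pow_add, neg_add, Real.exp_add, hwdef]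
    ring
  have hmul : ∀ x y, w (x + y) ≤ w x * w y := by
    intro x y
    rw [hprod]
    refine mul_le_mul_of_nonneg_right (Real.exp_le_exp.2 ?_) (by positivity)
    linarith [hUadd x y]
  have hvw : ∀ i x y, x ≠ 0 → y ≠ 0 → w (x + y) / ‖D i (x + y)‖ ≤ w x * w y := by
    intro i x y hx hy
    have hx1 : x.degree ≠ 0 := fun e => hx ((Finsupp.degree_eq_zero_iff _).1 e)
    have hy1 : y.degree ≠ 0 := fun e => hy ((Finsupp.degree_eq_zero_iff _).1 e)
    have hDpos := norm_pos_iff.2 (hD i (x + y) (by rw [map_add]; omega))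
    rw [hprod, div_le_iff₀ hDpos]
    have hexp : Real.exp (-U (x + y)) ≤ Real.exp (-(U x + U y)) * ‖D i (x + y)‖ := by
      conv_rhs => rw [← Real.exp_log hDpos, ← Real.exp_add]
      exact Real.exp_le_exp.2 (by linarith [hUD i x y hx hy])
    calc w (x + y) ≤ Real.exp (-(U x + U y)) * ‖D i (x + y)‖ * r ^ (x + y).degree :=
          mul_le_mul_of_nonneg_right hexp (by positivity)
      _ = _ := by ring
  have hwr : ∀ i, w (Finsupp.single i 1) ≤ r := by
    intro i
    have : Real.exp (-U (Finsupp.single i 1)) ≤ 1 :=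
      Real.exp_le_one_iff.2 (by linarith [hU0 (Finsupp.single i 1)])
    simpa [hwdef] using mul_le_mul_of_nonneg_right this hr.le
  intro i
  have hsum := summable_of_truncNorm_le hw fun N =>
    truncNorm_solution_le hD hf hh hw hw0 hmul hvw hr.le hwr
      (fun i N => hbd i r hr.le (hrr i) N) N i
  -- Since `U m ≤ C |m|`, the weight `w m` dominates `(exp (-C) * r) ^ |m|`.
  refine ⟨Real.exp (-C) * r, by positivity, Summable.of_nonneg_of_le (fun m => by positivity)
    (fun m => ?_) hsum⟩
  refine mul_le_mul_of_nonneg_left ?_ (norm_nonneg _)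
  rw [mul_pow, ← Real.exp_nat_mul]
  refine mul_le_mul_of_nonneg_right (Real.exp_le_exp.2 ?_) (by positivity)
  linarith [hUC m]

/-! ### The counting function -/

/-- A superadditive function which increases by one at each point of `S`, provided the points of
`S` are sparse at scale `n`. It bounds the number of divisors from `S` in the coefficient `m`. -/
def counting (S : Set (Fin ν →₀ ℕ)) (n : ℝ) (m : Fin ν →₀ ℕ) : ℝ :=
  sInf ({max 0 (2 * (m.degree : ℝ) / n - 1)} ∪
    {x | ∃ M ∈ S, m < M ∧ x = max 0 (2 * (M.degree : ℝ) / n - 2)})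

section counting

variable {S : Set (Fin ν →₀ ℕ)} {n : ℝ} {m x y : Fin ν →₀ ℕ}

theorem counting_bddBelow : BddBelow ({max 0 (2 * (m.degree : ℝ) / n - 1)} ∪
    {x | ∃ M ∈ S, m < M ∧ x = max 0 (2 * (M.degree : ℝ) / n - 2)}) := by
  refine ⟨0, ?_⟩
  rintro x (rfl | ⟨M, -, -, rfl⟩) <;> exact le_max_left _ _

theorem counting_le : counting S n m ≤ max 0 (2 * (m.degree : ℝ) / n - 1) :=
  csInf_le counting_bddBelow (Or.inl rfl)

theorem counting_le_of_lt {M : Fin ν →₀ ℕ} (hM : M ∈ S) (h : m < M) :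
    counting S n m ≤ max 0 (2 * (M.degree : ℝ) / n - 2) :=
  csInf_le counting_bddBelow (Or.inr ⟨M, hM, h, rfl⟩)

theorem le_counting {c : ℝ} (h1 : c ≤ max 0 (2 * (m.degree : ℝ) / n - 1))
    (h2 : ∀ M ∈ S, m < M → c ≤ max 0 (2 * (M.degree : ℝ) / n - 2)) : c ≤ counting S n m := by
  refine le_csInf ⟨_, Or.inl rfl⟩ ?_
  rintro x (rfl | ⟨M, hM, hlt, rfl⟩)
  exacts [h1, h2 M hM hlt]

theorem counting_nonneg : 0 ≤ counting S n m :=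
  le_counting (le_max_left _ _) fun _ _ _ => le_max_left _ _

theorem counting_mono (hn : 0 < n) (h : x ≤ y) : counting S n x ≤ counting S n y := by
  have hd : (x.degree : ℝ) ≤ y.degree := by exact_mod_cast Finsupp.degree_mono h
  refine le_counting (counting_le.trans ?_) fun M hM hlt => counting_le_of_lt hM (h.trans_lt hlt)
  gcongr

/-- If one argument has degree at most `n / 2` its value is zero and monotonicity suffices.
Otherwise the two constants `-1` add up to `-2`, which is below either candidate at `x + y`. -/
theorem counting_add_le (hn : 0 < n) :
    counting S n x + counting S n y ≤ counting S n (x + y) := by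
  by_cases hx : 2 * (x.degree : ℝ) / n - 1 ≤ 0
  · have h1 : counting S n x ≤ 0 := counting_le.trans (max_le le_rfl hx)
    linarith [counting_mono (S := S) hn (le_add_self : y ≤ x + y)]
  by_cases hy : 2 * (y.degree : ℝ) / n - 1 ≤ 0
  · have h1 : counting S n y ≤ 0 := counting_le.trans (max_le le_rfl hy)
    linarith [counting_mono (S := S) hn (le_self_add : x ≤ x + y)]
  have h1 : counting S n x ≤ 2 * (x.degree : ℝ) / n - 1 :=
    counting_le.trans (max_le (by linarith) le_rfl)
  have h2 : counting S n y ≤ 2 * (y.degree : ℝ) / n - 1 :=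
    counting_le.trans (max_le (by linarith) le_rfl)
  have h3 : 2 * ((x + y).degree : ℝ) / n = 2 * (x.degree : ℝ) / n + 2 * (y.degree : ℝ) / n := by
    rw [map_add]; push_cast; ring
  refine le_counting (le_max_of_le_right (by linarith)) fun M _ hlt => le_max_of_le_right ?_
  have hd : ((x + y).degree : ℝ) ≤ M.degree := by exact_mod_cast Finsupp.degree_mono hlt.le
  have : 2 * ((x + y).degree : ℝ) / n ≤ 2 * (M.degree : ℝ) / n := by gcongr
  linarith

/-- The gap makes each later point `M` of `S` give at least `2 |x + y| / n - 1`, so the value at `x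
+ y` is at least that. The two smaller values sum to at most `2 |x + y| / n - 2`. -/
theorem counting_add_one_le (hn : 0 < n) (hS : ∀ m ∈ S, n ≤ m.degree)
    (hgap : ∀ m ∈ S, ∀ M ∈ S, m < M → (m.degree : ℝ) + n ≤ M.degree)
    (hx : x ≠ 0) (hy : y ≠ 0) (hxy : x + y ∈ S) :
    1 + (counting S n x + counting S n y) ≤ counting S n (x + y) := by
  have h3 : 2 * ((x + y).degree : ℝ) / n = 2 * (x.degree : ℝ) / n + 2 * (y.degree : ℝ) / n := by
    rw [map_add]; push_cast; ring
  have h4 : 2 ≤ 2 * ((x + y).degree : ℝ) / n := by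
    rw [le_div_iff₀ hn]; linarith [hS _ hxy]
  have h5 : 2 * ((x + y).degree : ℝ) / n - 1 ≤ counting S n (x + y) := by
    refine le_counting (le_max_right _ _) fun M hM hlt => le_max_of_le_right ?_
    have h6 := hgap _ hxy M hM hlt
    have h7 : 2 * ((x + y).degree : ℝ) / n + 2 ≤ 2 * (M.degree : ℝ) / n := by
      rw [div_add' _ _ _ hn.ne', div_le_div_iff_of_pos_right hn]
      linarith
    linarith
  have h6 : counting S n x + counting S n y ≤ 2 * ((x + y).degree : ℝ) / n - 2 := by
    -- If one summand has degree at most `n / 2` it contributes zero, and the other lies strictly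
    -- below `x + y ∈ S`, so the second kind of candidate bounds it.
    by_cases hxs : 2 * (x.degree : ℝ) / n - 1 ≤ 0
    · have h1 : counting S n x ≤ 0 := counting_le.trans (max_le le_rfl hxs)
      have h2 := counting_le_of_lt (n := n) hxy
        (lt_add_of_pos_left y (pos_iff_ne_zero.2 hx))
      rw [max_eq_right (by linarith)] at h2
      linarith
    by_cases hys : 2 * (y.degree : ℝ) / n - 1 ≤ 0
    · have h1 : counting S n y ≤ 0 := counting_le.trans (max_le le_rfl hys)
      have h2 := counting_le_of_lt (n := n) hxy
        (lt_add_of_pos_right x (pos_iff_ne_zero.2 hy))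
      rw [max_eq_right (by linarith)] at h2
      linarith
    have h1 : counting S n x ≤ 2 * (x.degree : ℝ) / n - 1 :=
      counting_le.trans (max_le (by linarith) le_rfl)
    have h2 : counting S n y ≤ 2 * (y.degree : ℝ) / n - 1 :=
      counting_le.trans (max_le (by linarith) le_rfl)
    linarith
  linarith

theorem counting_le_div (hn : 0 < n) : counting S n m ≤ 2 * (m.degree : ℝ) / n :=
  counting_le.trans (max_le (by positivity) (by linarith))

end counting

/-! ### The Bruno condition -/

/-- Dyadic form of the Bruno series. -/
theorem summable_dyadic {L : ℕ → ℝ} (h0 : ∀ k, 0 ≤ L k) (hmono : Monotone L)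
    (hs : Summable fun k : ℕ => (1 / ((k : ℝ) + 1) - 1 / ((k : ℝ) + 2)) * L (k + 1)) :
    Summable fun k : ℕ => L (2 ^ (k + 1)) / 2 ^ k := by
  set g : ℕ → ℝ := fun k => (1 / ((k : ℝ) + 1) - 1 / ((k : ℝ) + 2)) * L (k + 1) with hg
  have hc : ∀ k : ℕ, 0 ≤ 1 / ((k : ℝ) + 1) - 1 / ((k : ℝ) + 2) := fun k =>
    sub_nonneg.2 (one_div_le_one_div_of_le (by positivity) (by linarith))
  have hg0 : ∀ k, 0 ≤ g k := fun k => mul_nonneg (hc k) (h0 _)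
  have htel : ∀ a b : ℕ, a ≤ b → ∑ k ∈ Finset.Ico a b, (1 / ((k : ℝ) + 1) - 1 / ((k : ℝ) + 2)) =
      1 / ((a : ℝ) + 1) - 1 / ((b : ℝ) + 1) := by
    intro a b hab
    induction b, hab using Nat.le_induction with
    | base => simp
    | succ b hab ih =>
      rw [Finset.sum_Ico_succ_top hab, ih]
      push_cast
      ring
  -- Over `2^(k+1) ≤ l + 1 < 2^(k+2)` the weights telescope to `1 / 2^(k+2)`, whence the factor 4.
  have hblock : ∀ k : ℕ, L (2 ^ (k + 1)) / 2 ^ k ≤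
      4 * ∑ l ∈ Finset.Ico (2 ^ (k + 1) - 1) (2 ^ (k + 2) - 1), g l := by
    intro k
    have h2 : ((2 ^ (k + 1) - 1 : ℕ) : ℝ) + 1 = 2 ^ (k + 1) := by
      rw [Nat.cast_sub Nat.one_le_two_pow]; push_cast; ring
    have h3 : ((2 ^ (k + 2) - 1 : ℕ) : ℝ) + 1 = 2 ^ (k + 2) := by
      rw [Nat.cast_sub Nat.one_le_two_pow]; push_cast; ring
    have h4 : (2 ^ (k + 1) - 1 : ℕ) ≤ 2 ^ (k + 2) - 1 :=
      Nat.sub_le_sub_right (Nat.pow_le_pow_right (by norm_num) (by omega)) 1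
    have h5 : (∑ l ∈ Finset.Ico (2 ^ (k + 1) - 1 : ℕ) (2 ^ (k + 2) - 1),
        (1 / ((l : ℝ) + 1) - 1 / ((l : ℝ) + 2))) * L (2 ^ (k + 1)) ≤
        ∑ l ∈ Finset.Ico (2 ^ (k + 1) - 1) (2 ^ (k + 2) - 1), g l := by
      rw [Finset.sum_mul]
      refine Finset.sum_le_sum fun l hl => mul_le_mul_of_nonneg_left (hmono ?_) (hc l)
      have := (Finset.mem_Ico.1 hl).1
      omega
    rw [htel _ _ h4, h2, h3] at h5
    refine le_trans (le_of_eq ?_) (mul_le_mul_of_nonneg_left h5 (by norm_num))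
    rw [pow_succ (2 : ℝ) (k + 1), pow_succ (2 : ℝ) k]
    field_simp
    ring
  have hpart : ∀ K : ℕ, ∑ k ∈ Finset.range K, L (2 ^ (k + 1)) / 2 ^ k ≤
      4 * ∑ l ∈ Finset.range (2 ^ (K + 1) - 1), g l := by
    intro K
    induction K with
    | zero =>
      rw [Finset.sum_range_zero]
      exact mul_nonneg (by norm_num) (Finset.sum_nonneg fun l _ => hg0 l)
    | succ K ih =>
      rw [Finset.sum_range_succ, ← Finset.sum_range_add_sum_Ico g (m := 2 ^ (K + 1) - 1)
        (n := 2 ^ (K + 1 + 1) - 1)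
        (Nat.sub_le_sub_right (Nat.pow_le_pow_right (by norm_num) (by omega)) 1), mul_add]
      exact add_le_add ih (hblock K)
  refine summable_of_sum_range_le (c := 4 * ∑' k, g k)
    (fun k => div_nonneg (h0 _) (by positivity)) fun K => (hpart K).trans ?_
  exact mul_le_mul_of_nonneg_left (hs.sum_le_tsum _ fun k _ => hg0 k) (by norm_num)

/-- Lower bounds `Om` for small divisors `dd`, which behave like distances to a subgroup, subject
to the Bruno condition. -/
structure BrunoBounds (dd : Fin ν → (Fin ν →₀ ℕ) → ℝ) (Om : ℕ → ℝ) : Prop where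
  pos : ∀ k, 0 < Om k
  le_one : ∀ k, Om k ≤ 1
  anti : Antitone Om
  le_divisor : ∀ k j (m : Fin ν →₀ ℕ), 2 ≤ m.degree → m.degree ≤ k + 1 → Om k ≤ dd j m
  sub_le : ∀ j m z, dd j (Finsupp.single j 1 + z) ≤ dd j (m + z) + dd j m
  summable : Summable fun k : ℕ =>
    (1 / ((k : ℝ) + 1) - 1 / ((k : ℝ) + 2)) * Real.log (1 / Om (k + 1))

/-- `U` has two parts: a multiple of `|m| - 1`, which pays `A` and the divisors that are not small,
and a weighted sum of counting functions, which pays the small ones scale by scale. -/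
theorem exists_superadditive {dd : Fin ν → (Fin ν →₀ ℕ) → ℝ} {Om : ℕ → ℝ} (H : BrunoBounds dd Om)
    {A : ℝ} (hA : 0 ≤ A) :
    ∃ (U : (Fin ν →₀ ℕ) → ℝ) (C : ℝ), (∀ m, 0 ≤ U m) ∧ (∀ m, U m ≤ C * m.degree) ∧
      (∀ x y, U x + U y ≤ U (x + y)) ∧
      ∀ j x y, x ≠ 0 → y ≠ 0 →
        A + max 0 (-Real.log (dd j (x + y))) + (U x + U y) ≤ U (x + y) := by
  set S : ℕ → Fin ν → Set (Fin ν →₀ ℕ) :=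
    fun k j => {m | 2 ≤ m.degree ∧ dd j m < Om (2 ^ k) / 2} with hSdef
  have hpow : ∀ k : ℕ, (0 : ℝ) < 2 ^ k := fun k => by positivity
  have hSlarge : ∀ k j, ∀ m ∈ S k j, (2 : ℝ) ^ k ≤ m.degree := by
    rintro k j m ⟨hm2, hm⟩
    by_contra hlt
    have hlt : m.degree < 2 ^ k := by exact_mod_cast not_le.1 hlt
    have := H.le_divisor (2 ^ k) j m hm2 (by omega)
    linarith [H.pos (2 ^ k)]
  -- For `M = m + z`, the two divisors, each below half of `Om (2 ^ k)`, force the divisor at `e_j +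
  -- z` below `Om (2 ^ k)`. This is impossible if `|e_j + z| ≤ 2^k + 1`.
  have hSgap : ∀ k j, ∀ m ∈ S k j, ∀ M ∈ S k j, m < M →
      (m.degree : ℝ) + 2 ^ k ≤ M.degree := by
    rintro k j m ⟨-, hm⟩ M ⟨-, hM⟩ hlt
    obtain ⟨z, rfl⟩ := exists_add_of_le hlt.le
    have hz : z.degree ≠ 0 := by
      intro hz
      rw [(Finsupp.degree_eq_zero_iff _).1 hz, add_zero] at hlt
      exact lt_irrefl _ hlt
    by_contra hcon
    have hcon : z.degree < 2 ^ k := by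
      rw [map_add] at hcon
      push_cast at hcon
      have : (z.degree : ℝ) < 2 ^ k := by linarith
      exact_mod_cast this
    have h1 := H.le_divisor (2 ^ k) j (Finsupp.single j 1 + z)
      (by rw [map_add, Finsupp.degree_single]; omega)
      (by rw [map_add, Finsupp.degree_single]; omega)
    linarith [H.sub_le j m z]
  -- This is the price of a divisor small at scale `k` but not at scale `k + 1`, hence at least `Om
  -- (2 ^ (k + 1)) / 2`.
  set b : ℕ → ℝ := fun k => Real.log (2 / Om (2 ^ (k + 1))) with hb
  have hL0 : ∀ k, 0 ≤ Real.log (1 / Om k) := fun k =>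
    Real.log_nonneg ((one_le_div (H.pos k)).2 (H.le_one k))
  have hbL : ∀ k, b k = Real.log 2 + Real.log (1 / Om (2 ^ (k + 1))) := by
    intro k
    have := H.pos (2 ^ (k + 1))
    rw [← Real.log_mul two_ne_zero (by positivity), mul_one_div]
  have hb0 : ∀ k, 0 ≤ b k := fun k => by
    rw [hbL]
    exact add_nonneg (Real.log_nonneg one_le_two) (hL0 _)
  have hbs : Summable fun k => b k / 2 ^ k := by
    have h1 := summable_dyadic hL0 (fun k l hkl => Real.log_le_log
      (div_pos one_pos (H.pos k)) (one_div_le_one_div_of_le (H.pos l) (H.anti hkl))) H.summable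
    have h2 : Summable fun k : ℕ => Real.log 2 * (1 / 2 : ℝ) ^ k :=
      summable_geometric_two.mul_left _
    refine (h2.add h1).congr fun k => ?_
    rw [hbL, one_div, inv_pow]
    ring
  set Φ : ℕ → (Fin ν →₀ ℕ) → ℝ := fun k m => ∑ j, counting (S k j) (2 ^ k) m with hΦ
  have hΦ0 : ∀ k m, 0 ≤ Φ k m := fun k m => Finset.sum_nonneg fun j _ => counting_nonneg
  have hΦle : ∀ k m, b k * Φ k m ≤ 2 * ν * (m.degree : ℝ) * (b k / 2 ^ k) := by
    intro k m
    have : Φ k m ≤ ν * (2 * (m.degree : ℝ) / 2 ^ k) := by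
      refine (Finset.sum_le_sum fun j _ => counting_le_div (hpow k)).trans (le_of_eq ?_)
      rw [Finset.sum_const, Finset.card_univ, Fintype.card_fin, nsmul_eq_mul]
    refine (mul_le_mul_of_nonneg_left this (hb0 k)).trans (le_of_eq ?_)
    ring
  have hΦadd : ∀ k x y, Φ k x + Φ k y ≤ Φ k (x + y) := by
    intro k x y
    rw [hΦ, ← Finset.sum_add_distrib]
    exact Finset.sum_le_sum fun j _ => counting_add_le (hpow k)
  have hΦadd1 : ∀ k j x y, x ≠ 0 → y ≠ 0 → x + y ∈ S k j →
      1 + (Φ k x + Φ k y) ≤ Φ k (x + y) := by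
    intro k j x y hx hy hxy
    have h1 : ∑ i, ((if i = j then (1 : ℝ) else 0) +
        (counting (S k i) (2 ^ k) x + counting (S k i) (2 ^ k) y)) ≤ Φ k (x + y) := by
      refine Finset.sum_le_sum fun i _ => ?_
      split_ifs with hij
      · subst hij
        exact counting_add_one_le (hpow k) (hSlarge k i) (hSgap k i) hx hy hxy
      · rw [zero_add]
        exact counting_add_le (hpow k)
    rwa [Finset.sum_add_distrib, Finset.sum_add_distrib, Finset.sum_ite_eq' Finset.univ j,
      if_pos (Finset.mem_univ j)] at h1
  have hsum : ∀ m, Summable fun k => b k * Φ k m := fun m =>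
    Summable.of_nonneg_of_le (fun k => mul_nonneg (hb0 k) (hΦ0 k m)) (fun k => hΦle k m)
      (hbs.mul_left _)
  set T : (Fin ν →₀ ℕ) → ℝ := fun m => ∑' k, b k * Φ k m with hT
  have hT0 : ∀ m, 0 ≤ T m := fun m => tsum_nonneg fun k => mul_nonneg (hb0 k) (hΦ0 k m)
  have hTadd : ∀ x y, T x + T y ≤ T (x + y) := by
    intro x y
    rw [hT, ← (hsum x).tsum_add (hsum y)]
    refine ((hsum x).add (hsum y)).tsum_le_tsum (fun k => ?_) (hsum _)
    rw [← mul_add]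
    exact mul_le_mul_of_nonneg_left (hΦadd k x y) (hb0 k)
  have hTadd1 : ∀ k j x y, x ≠ 0 → y ≠ 0 → x + y ∈ S k j →
      b k + (T x + T y) ≤ T (x + y) := by
    intro k j x y hx hy hxy
    have hs := ((hsum (x + y)).sub ((hsum x).add (hsum y)))
    have h1 : b k ≤ ∑' l, (b l * Φ l (x + y) - (b l * Φ l x + b l * Φ l y)) := by
      refine le_trans ?_ (hs.le_tsum k fun l _ => ?_)
      · nlinarith [hb0 k, hΦadd1 k j x y hx hy hxy]
      · nlinarith [hb0 l, hΦadd l x y]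
    rw [(hsum (x + y)).tsum_sub ((hsum x).add (hsum y)), (hsum x).tsum_add (hsum y)] at h1
    linarith
  set C₀ : ℝ := A + Real.log (2 / Om 1) with hC₀
  have hlog1 : 0 ≤ Real.log (2 / Om 1) :=
    Real.log_nonneg ((one_le_div (H.pos 1)).2 ((H.le_one 1).trans one_le_two))
  have hC₀0 : 0 ≤ C₀ := add_nonneg hA hlog1
  -- For nonzero `x` and `y`, `|m| - 1` gains exactly one on passing to `x + y`. Truncated
  -- subtraction gives the value 0 at `m = 0`.
  refine ⟨fun m => C₀ * ((m.degree - 1 : ℕ) : ℝ) + T m, C₀ + 2 * ν * ∑' k, b k / 2 ^ k,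
    fun m => add_nonneg (by positivity) (hT0 m), fun m => ?_, fun x y => ?_,
    fun j x y hx hy => ?_⟩
  · have h1 : T m ≤ 2 * ν * (m.degree : ℝ) * ∑' k, b k / 2 ^ k := by
      rw [← tsum_mul_left]
      exact (hsum m).tsum_le_tsum (fun k => hΦle k m) (hbs.mul_left _)
    have h2 : ((m.degree - 1 : ℕ) : ℝ) ≤ m.degree := by exact_mod_cast Nat.sub_le _ _
    have h3 := mul_le_mul_of_nonneg_left h2 hC₀0
    linarith
  · have h1 : ((x.degree - 1 : ℕ) : ℝ) + ((y.degree - 1 : ℕ) : ℝ) ≤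
        (((x + y).degree - 1 : ℕ) : ℝ) := by
      rw [map_add]
      exact_mod_cast (by omega : x.degree - 1 + (y.degree - 1) ≤ x.degree + y.degree - 1)
    have h2 := mul_le_mul_of_nonneg_left h1 hC₀0
    have h3 := hTadd x y
    dsimp only
    linarith
  · have hx1 : x.degree ≠ 0 := fun e => hx ((Finsupp.degree_eq_zero_iff _).1 e)
    have hy1 : y.degree ≠ 0 := fun e => hy ((Finsupp.degree_eq_zero_iff _).1 e)
    have hdeg : 2 ≤ (x + y).degree := by rw [map_add]; omega
    have h1 : (((x + y).degree - 1 : ℕ) : ℝ) =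
        1 + (((x.degree - 1 : ℕ) : ℝ) + ((y.degree - 1 : ℕ) : ℝ)) := by
      rw [map_add]
      exact_mod_cast (by omega : x.degree + y.degree - 1 = 1 + (x.degree - 1 + (y.degree - 1)))
    have hdpos : 0 < dd j (x + y) :=
      (H.pos _).trans_le (H.le_divisor (x + y).degree j (x + y) hdeg (by omega))
    have key : max 0 (-Real.log (dd j (x + y))) + (T x + T y) ≤
        Real.log (2 / Om 1) + T (x + y) := by
      by_cases hbig : Om 1 / 2 ≤ dd j (x + y)
      · have h2 : -Real.log (dd j (x + y)) ≤ Real.log (2 / Om 1) := by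
          rw [← Real.log_inv]
          refine Real.log_le_log (by positivity) ?_
          rw [← inv_div (Om 1) 2]
          exact inv_anti₀ (half_pos (H.pos 1)) hbig
        exact add_le_add (max_le hlog1 h2) (hTadd x y)
      -- The first scale at which the divisor is not small is some `k + 1`; then `x + y ∈ S k j`,
      -- and the jump there, weighted by `b k`, pays for it.
      · have hex : ∃ k, Om (2 ^ k) / 2 ≤ dd j (x + y) := by
          refine ⟨(x + y).degree, ?_⟩
          have := H.le_divisor (2 ^ (x + y).degree) j (x + y) hdeg
            (Nat.lt_two_pow_self.le.trans (Nat.le_succ _))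
          linarith [H.pos (2 ^ (x + y).degree)]
        classical
        obtain ⟨k, hk⟩ : ∃ k, Nat.find hex = k + 1 := by
          refine Nat.exists_eq_succ_of_ne_zero fun h0 => hbig ?_
          have := Nat.find_spec hex
          rwa [h0, pow_zero] at this
        have hk1 := Nat.find_spec hex
        rw [hk] at hk1
        have hk2 := Nat.find_min hex (m := k) (by omega)
        have h2 : -Real.log (dd j (x + y)) ≤ b k := by
          rw [← Real.log_inv]
          refine Real.log_le_log (by positivity) ?_
          rw [← inv_div (Om (2 ^ (k + 1))) 2]
          exact inv_anti₀ (half_pos (H.pos _)) hk1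
        have h3 := hTadd1 k j x y hx hy ⟨hdeg, not_le.1 hk2⟩
        have h4 : max 0 (-Real.log (dd j (x + y))) ≤ b k := max_le (hb0 k) h2
        linarith
    dsimp only
    rw [h1]
    have h5 : C₀ * (1 + (((x.degree - 1 : ℕ) : ℝ) + ((y.degree - 1 : ℕ) : ℝ))) =
        A + Real.log (2 / Om 1) + C₀ * ((x.degree - 1 : ℕ) : ℝ) +
          C₀ * ((y.degree - 1 : ℕ) : ℝ) := by rw [hC₀]; ring
    rw [h5]
    linarith

/-! ### Small divisors -/

theorem pairing_add (m m' : Fin ν →₀ ℕ) (lam : Fin ν → ℂ) :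
    pairing (m + m') lam = pairing m lam + pairing m' lam := by
  simp only [pairing, Finsupp.add_apply, Nat.cast_add, add_mul, Finset.sum_add_distrib]

theorem pairing_single (j : Fin ν) (lam : Fin ν → ℂ) :
    pairing (Finsupp.single j 1) lam = lam j := by
  classical
  rw [pairing, Finset.sum_eq_single_of_mem j (Finset.mem_univ j)]
  · simp
  · intro i _ hi
    simp [Finsupp.single_eq_of_ne hi]

/-- Both problems are covered: `N` is the norm for vector fields and the distance to the integers
for diffeomorphisms. -/
theorem brunoBounds_of_quasinorm {N : ℂ → ℝ} (hN : ∀ u v, N (u - v) ≤ N u + N v)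
    {lam : Fin ν → ℂ} {Om : ℕ → ℝ}
    (hpos : ∀ j (m : Fin ν →₀ ℕ), 2 ≤ m.degree → 0 < N (pairing m lam - lam j))
    (hOm : ∀ k, IsLeast ({1} ∪ {x | ∃ (j : Fin ν) (m : Fin ν →₀ ℕ), 2 ≤ m.degree ∧
      m.degree ≤ k + 1 ∧ x = N (pairing m lam - lam j)}) (Om k))
    (hs : ∑' k : ℕ, ENNReal.ofReal
      ((1 / ((k : ℝ) + 1) - 1 / ((k : ℝ) + 2)) * Real.log (1 / Om (k + 1))) < ⊤) :
    BrunoBounds (fun j m => N (pairing m lam - lam j)) Om := by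
  have h1 : ∀ k, 0 < Om k := by
    intro k
    rcases (hOm k).1 with h | ⟨j, m, h2, -, h⟩
    · rw [h]; exact one_pos
    · rw [h]; exact hpos j m h2
  have h2 : ∀ k, Om k ≤ 1 := fun k => (hOm k).2 (Or.inl rfl)
  refine ⟨h1, h2, fun k l hkl => (hOm l).2 ?_, fun k j m hm hmk => (hOm k).2 (Or.inr
    ⟨j, m, hm, hmk, rfl⟩), fun j m z => ?_, ?_⟩
  · rcases (hOm k).1 with h | ⟨j, m, h2, h3, h⟩
    · exact Or.inl h
    · exact Or.inr ⟨j, m, h2, by omega, h⟩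
  -- Subtracting the divisors at `m + z` and `m` cancels `lam j`; adding `e_j` restores it.
  · refine le_trans (le_of_eq ?_) (hN _ _)
    congr 1
    rw [pairing_add, pairing_add, pairing_single]
    ring
  · have h3 := ENNReal.tsum_coe_ne_top_iff_summable.1 hs.ne
    refine (NNReal.summable_coe.2 h3).congr fun k => Real.coe_toNNReal _ (mul_nonneg ?_ ?_)
    · exact sub_nonneg.2 (one_div_le_one_div_of_le (by positivity) (by linarith))
    · exact Real.log_nonneg ((one_le_div (h1 _)).2 (h2 _))

/-- The abstract linearization theorem. -/
theorem exists_unique_convergent_solution {D : Fin ν → (Fin ν →₀ ℕ) → ℂ} {f : Tuple ν}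
    {dd : Fin ν → (Fin ν →₀ ℕ) → ℝ} {Om : ℕ → ℝ} (H : BrunoBounds dd Om) {c : ℝ} (hc : 0 < c)
    (hc1 : c ≤ 1) (hD : ∀ i (m : Fin ν →₀ ℕ), 2 ≤ m.degree → c * min 1 (dd i m) ≤ ‖D i m‖)
    (hf : f ∈ nonlinearTuples ν) (hfc : Convergent f) :
    ∃ h, Solves D f h ∧ (∀ h', Solves D f h' → h' = h) ∧ Convergent h := by
  have hdd : ∀ i (m : Fin ν →₀ ℕ), 2 ≤ m.degree → 0 < dd i m := fun i m hm =>
    (H.pos _).trans_le (H.le_divisor m.degree i m hm (by omega))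
  have hD0 : ∀ i (m : Fin ν →₀ ℕ), 2 ≤ m.degree → D i m ≠ 0 := fun i m hm =>
    norm_pos_iff.1 ((mul_pos hc (lt_min one_pos (hdd i m hm))).trans_le (hD i m hm))
  obtain ⟨h, hh⟩ := exists_solves hD0 hf
  obtain ⟨U, C, hU0, hUC, hUadd, hUD⟩ :=
    exists_superadditive H (A := -Real.log c) (neg_nonneg.2 (Real.log_nonpos hc.le hc1))
  refine ⟨h, hh, fun h' hh' => solves_unique hD0 hf hh hh',
    hh.convergent hD0 hf hfc hU0 hUC hUadd fun i x y hx hy => le_trans ?_ (hUD i x y hx hy)⟩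
  have hx1 : x.degree ≠ 0 := fun e => hx ((Finsupp.degree_eq_zero_iff _).1 e)
  have hy1 : y.degree ≠ 0 := fun e => hy ((Finsupp.degree_eq_zero_iff _).1 e)
  have hdeg : 2 ≤ (x + y).degree := by rw [map_add]; omega
  have hp := hdd i _ hdeg
  have h1 := Real.log_le_log (mul_pos hc (lt_min one_pos hp)) (hD i _ hdeg)
  rw [Real.log_mul hc.ne' (lt_min one_pos hp).ne'] at h1
  have h2 : -Real.log (min 1 (dd i (x + y))) ≤ max 0 (-Real.log (dd i (x + y))) := by
    rcases min_choice 1 (dd i (x + y)) with h | h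
    · rw [h, Real.log_one, neg_zero]; exact le_max_left _ _
    · rw [h]; exact le_max_right _ _
  linarith

/-! ### Vector fields -/

theorem coeff_diagTuple_mul_pderiv (lam : Fin ν → ℂ) (j : Fin ν) (p : MvPowerSeries (Fin ν) ℂ)
    (m : Fin ν →₀ ℕ) :
    coeff m (diagTuple lam j * pderiv ℂ j p) = (m j : ℂ) * lam j * coeff m p := by
  classical
  rw [diagTuple, mul_assoc, coeff_C_mul, X, coeff_monomial_mul, one_mul, coeff_pderiv]
  split_ifs with h
  · have h1 : 1 ≤ m j := by simpa using h j
    rw [tsub_add_cancel_of_le h, Finsupp.tsub_apply, Finsupp.single_eq_same,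
      Nat.cast_sub h1]
    push_cast
    ring
  · have h1 : m j = 0 := by
      by_contra h0
      refine h (Finsupp.single_le_iff.2 (Nat.one_le_iff_ne_zero.2 h0))
    rw [h1]
    simp

theorem comp_add_apply {f g h : Tuple ν} (h0 : ∀ i, constantCoeff (h i) = 0) (i : Fin ν) :
    comp (f + g) h i = comp f h i + comp g h i :=
  subst_add (hasSubst_of_constantCoeff_zero h0) _ _

theorem comp_diagTuple {q : Fin ν → ℂ} {h : Tuple ν} (h0 : ∀ i, constantCoeff (h i) = 0)
    (i : Fin ν) : comp (diagTuple q) h i = C (q i) * h i := by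
  have hs := hasSubst_of_constantCoeff_zero h0
  rw [comp, diagTuple, ← smul_eq_C_mul, ← smul_eq_C_mul, subst_smul hs, subst_X hs]

theorem coeff_X_eq_zero_of_ne {i : Fin ν} {m : Fin ν →₀ ℕ}
    (hm : m ≠ Finsupp.single i 1) : coeff m (X i : MvPowerSeries (Fin ν) ℂ) = 0 := by
  classical
  rw [coeff_X, if_neg hm]

/-- The operator `∑ lam_j z_j ∂_j` is diagonal on monomials, with eigenvalue `m · lam`. In degree at
most one, tangency to the identity already gives the equation. -/
theorem linearizesField_iff {lam : Fin ν → ℂ} {a h : Tuple ν} (ha : a ∈ nonlinearTuples ν) :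
    LinearizesField lam (diagTuple lam + a) h ↔
      Solves (fun i m => pairing m lam - lam i) a h := by
  refine and_congr_right fun hh => forall_congr' fun i => ?_
  have h0 := constantCoeff_of_mem_tangentToId hh
  rw [MvPowerSeries.ext_iff, comp_add_apply h0, comp_diagTuple h0]
  refine forall_congr' fun m => ?_
  rw [map_sum, map_add, coeff_C_mul]
  simp only [coeff_diagTuple_mul_pderiv]
  rw [← Finset.sum_mul, ← pairing]
  by_cases hm : m.degree ≤ 1
  · refine iff_of_true ?_ fun h2 => by omega
    rw [comp, coeff_subst_of_degree_le_one h0 (ha i) hm, add_zero,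
      mem_tangentToId_iff.1 hh i m hm]
    by_cases hmi : m = Finsupp.single i 1
    · rw [hmi, pairing_single]
    · rw [coeff_X_eq_zero_of_ne hmi, mul_zero, mul_zero]
  · have hm : 2 ≤ m.degree := by omega
    rw [imp_iff_right hm, sub_mul, sub_eq_iff_eq_add']

theorem seriesConvergent_of_coeff_le {f g : MvPowerSeries (Fin ν) ℂ} (hg : SeriesConvergent g)
    {K : ℝ} (h : ∀ m, ‖coeff m f‖ ≤ K * ‖coeff m g‖) : SeriesConvergent f := by
  obtain ⟨r, hr, hs⟩ := hg
  refine ⟨r, hr, Summable.of_nonneg_of_le (fun m => by positivity) (fun m => ?_) (hs.mul_left K)⟩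
  rw [← mul_assoc]
  exact mul_le_mul_of_nonneg_right (h m) (by positivity)

theorem coeff_diagTuple_of_two_le {q : Fin ν → ℂ} (i : Fin ν) {m : Fin ν →₀ ℕ}
    (hm : 2 ≤ m.degree) : coeff m (diagTuple q i) = 0 := by
  rw [diagTuple, coeff_C_mul, coeff_X_eq_zero_of_ne, mul_zero]
  rintro rfl
  simp at hm

theorem linearization_field (lam : Fin ν → ℂ) (a : Tuple ν) (ha : a ∈ nonlinearTuples ν)
    (hV : Convergent (diagTuple lam + a)) (hres : NonResonantField lam)
    (hB : BrunoSeriesField lam < ⊤) :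
    ∃ h : Tuple ν, LinearizesField lam (diagTuple lam + a) h ∧
      (∀ h', LinearizesField lam (diagTuple lam + a) h' → h' = h) ∧ Convergent h := by
  simp only [linearizesField_iff ha]
  have hpos : ∀ j (m : Fin ν →₀ ℕ), 2 ≤ m.degree → 0 < ‖pairing m lam - lam j‖ :=
    fun j m hm => norm_pos_iff.2 (sub_ne_zero.2 (hres j m hm).symm)
  have H := brunoBounds_of_quasinorm norm_sub_le hpos (smallDivisorsField_isLeast lam) hB
  refine exists_unique_convergent_solution H one_pos le_rfl
    (fun i m _ => (one_mul _).trans_le (min_le_right _ _)) ha fun i => ?_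
  refine seriesConvergent_of_coeff_le (hV i) (K := 1) fun m => ?_
  rw [one_mul]
  by_cases hm : m.degree ≤ 1
  · rw [ha i m hm, norm_zero]; exact norm_nonneg _
  · rw [Pi.add_apply, map_add, coeff_diagTuple_of_two_le i (by omega), zero_add]

/-! ### Diffeomorphisms -/

theorem exp_pairing_exponents {q : Fin ν → ℂ} (hq : ∀ j, q j ≠ 0) (m : Fin ν →₀ ℕ) :
    Complex.exp (2 * Real.pi * Complex.I * pairing m (exponents q)) = monomialValue q m := by
  rw [pairing, Finset.mul_sum, Complex.exp_sum, monomialValue]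
  refine Finset.prod_congr rfl fun i _ => ?_
  rw [mul_left_comm, Complex.exp_nat_mul, exp_exponents hq]

theorem exp_divisor {q : Fin ν → ℂ} (hq : ∀ j, q j ≠ 0) (i : Fin ν) (m : Fin ν →₀ ℕ) :
    Complex.exp (2 * Real.pi * Complex.I * (pairing m (exponents q) - exponents q i)) =
      monomialValue q m / q i := by
  rw [mul_sub, Complex.exp_sub, exp_pairing_exponents hq, exp_exponents hq]

/-! ### Distance to the integers and the size of `exp (2 π i w) - 1` -/

theorem exists_distInt_eq (w : ℂ) : ∃ n : ℤ, distInt w = ‖w - n‖ := by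
  obtain ⟨y, ⟨n, rfl⟩, hn⟩ := Complex.isClosed_range_intCast.exists_infDist_eq_dist
    (Set.range_nonempty _) w
  exact ⟨n, hn.trans (dist_eq_norm _ _)⟩

theorem distInt_le (w : ℂ) (n : ℤ) : distInt w ≤ ‖w - n‖ := by
  rw [← dist_eq_norm]
  exact Metric.infDist_le_dist_of_mem ⟨n, rfl⟩

theorem distInt_sub_le (u v : ℂ) : distInt (u - v) ≤ distInt u + distInt v := by
  obtain ⟨n, hn⟩ := exists_distInt_eq u
  obtain ⟨k, hk⟩ := exists_distInt_eq v
  rw [hn, hk]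
  refine (distInt_le _ (n - k)).trans (le_trans (le_of_eq ?_) (norm_sub_le _ _))
  congr 1
  push_cast
  ring

theorem exp_two_pi_I_mul_sub_int (w : ℂ) (n : ℤ) :
    Complex.exp (2 * Real.pi * Complex.I * (w - n)) =
      Complex.exp (2 * Real.pi * Complex.I * w) := by
  rw [mul_sub, Complex.exp_sub, mul_comm _ (n : ℂ), Complex.exp_int_mul_two_pi_mul_I, div_one]

theorem norm_exp_sub_one_sq (x y : ℝ) :
    ‖Complex.exp (2 * Real.pi * Complex.I * (x + y * Complex.I)) - 1‖ ^ 2 =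
      (Real.exp (-(2 * Real.pi * y)) - 1) ^ 2 +
        4 * Real.exp (-(2 * Real.pi * y)) * Real.sin (Real.pi * x) ^ 2 := by
  have h1 : (2 * Real.pi * Complex.I * (x + y * Complex.I) : ℂ) =
      (-(2 * Real.pi * y) : ℝ) + (2 * (Real.pi * x) : ℝ) * Complex.I := by
    push_cast
    linear_combination (2 * Real.pi * y : ℂ) * Complex.I_mul_I
  rw [h1, ← Complex.normSq_eq_norm_sq, Complex.normSq_apply, Complex.sub_re, Complex.sub_im,
    Complex.exp_re, Complex.exp_im]
  simp only [Complex.add_re, Complex.add_im, Complex.ofReal_re, Complex.ofReal_im,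
    Complex.re_ofReal_mul, Complex.im_ofReal_mul, Complex.I_re, Complex.I_im, Complex.one_re,
    Complex.one_im, mul_zero, mul_one, add_zero, zero_add, sub_zero]
  rw [Real.cos_two_mul, Real.sin_two_mul]
  have := Real.sin_sq_add_cos_sq (Real.pi * x)
  set E := Real.exp (-(2 * Real.pi * y))
  set s := Real.sin (Real.pi * x)
  set c := Real.cos (Real.pi * x)
  have hc : c ^ 2 = 1 - s ^ 2 := by linarith
  linear_combination (4 * E ^ 2 * c ^ 2 - 4 * E) * hc

/-- By periodicity the real part `x` may be taken in `[-1/2, 1/2]`. If the modulus `E` of the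
exponential is below 1/2, the right side exceeds 1/2. Otherwise Jordan's inequality bounds `|x|` and
the inequality `t + 1 ≤ exp t` bounds `|y|`, each by the right side. -/
theorem half_min_distInt_le (w : ℂ) :
    1 / 2 * min 1 (distInt w) ≤ ‖Complex.exp (2 * Real.pi * Complex.I * w) - 1‖ := by
  set n : ℤ := round w.re with hn
  set x : ℝ := w.re - n with hx
  set y : ℝ := w.im with hy
  have hwn : w - n = x + y * Complex.I := by
    apply Complex.ext <;> simp [hx, hy]
  have hxs : |x| ≤ 1 / 2 := abs_sub_round w.re
  have hdist : distInt w ≤ |x| + |y| := by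
    refine (distInt_le w n).trans ?_
    rw [hwn]
    refine (norm_add_le _ _).trans (le_of_eq ?_)
    simp
  rw [← exp_two_pi_I_mul_sub_int w n, hwn]
  have hsq := norm_exp_sub_one_sq x y
  set z := Complex.exp (2 * Real.pi * Complex.I * (x + y * Complex.I)) - 1 with hz
  set E := Real.exp (-(2 * Real.pi * y)) with hE
  have hE0 : 0 < E := Real.exp_pos _
  have hpi := Real.pi_gt_three
  have hzE : |E - 1| ≤ ‖z‖ := by
    refine abs_le_of_sq_le_sq ?_ (norm_nonneg _)
    rw [hsq]
    exact le_add_of_nonneg_right (by positivity)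
  rcases lt_or_ge E (1 / 2) with h | h
  · have h1 := neg_abs_le (E - 1)
    linarith [min_le_left 1 (distInt w)]
  · have hxz : |x| ≤ ‖z‖ := by
      have h1 : 2 / Real.pi * |Real.pi * x| ≤ |Real.sin (Real.pi * x)| := by
        refine Real.mul_abs_le_abs_sin ?_
        rw [abs_mul, abs_of_pos Real.pi_pos]
        nlinarith
      rw [abs_mul, abs_of_pos Real.pi_pos, ← mul_assoc, div_mul_cancel₀ _ Real.pi_ne_zero] at h1
      have h2 : (2 * |x|) ^ 2 ≤ Real.sin (Real.pi * x) ^ 2 := by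
        rw [← sq_abs (Real.sin _)]
        exact pow_le_pow_left₀ (by positivity) h1 2
      refine abs_le_of_sq_le_sq ?_ (norm_nonneg _)
      rw [hsq, ← sq_abs x]
      nlinarith [sq_nonneg (E - 1), sq_nonneg |x|,
        mul_le_mul_of_nonneg_right h (sq_nonneg (Real.sin (Real.pi * x)))]
    have hyz : |y| ≤ ‖z‖ := by
      refine le_trans ?_ hzE
      rcases le_total y 0 with h0 | h0
      · have h1 := Real.add_one_le_exp (-(2 * Real.pi * y))
        rw [abs_of_nonpos h0]
        refine le_trans ?_ (le_abs_self _)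
        nlinarith
      · have h1 := Real.add_one_le_exp (2 * Real.pi * y)
        have h2 : E * Real.exp (2 * Real.pi * y) = 1 := by
          rw [hE, ← Real.exp_add, neg_add_cancel, Real.exp_zero]
        have h3 : E * (2 * Real.pi * y + 1) ≤ 1 := by
          exact (mul_le_mul_of_nonneg_left h1 hE0.le).trans_eq h2
        rw [abs_of_nonneg h0, abs_sub_comm]
        refine le_trans ?_ (le_abs_self _)
        have h4 : y ≤ E * (2 * Real.pi * y) := by
          have : 1 / 2 * (2 * Real.pi * y) ≤ E * (2 * Real.pi * y) :=
            mul_le_mul_of_nonneg_right h (by positivity)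
          nlinarith
        linarith
    linarith [min_le_right 1 (distInt w)]

/-! ### The conjugacy equation of a diffeomorphism in coefficients -/

theorem comp_diagTuple_id_add (q : Fin ν → ℂ) {a : Tuple ν} (ha : a ∈ nonlinearTuples ν)
    (i : Fin ν) : comp (diagTuple q) (idTuple ν + a) i = C (q i) * (X i + a i) := by
  refine comp_diagTuple (fun j => ?_) i
  rw [Pi.add_apply, map_add, idTuple, constantCoeff_X, zero_add,
    ← coeff_zero_eq_constantCoeff_apply, ha j 0 (by simp)]

theorem coeff_comp_diagTuple (q : Fin ν → ℂ) (h : Tuple ν) (i : Fin ν) (m : Fin ν →₀ ℕ) :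
    coeff m (comp h (diagTuple q) i) = monomialValue q m * coeff m (h i) := by
  have h1 : diagTuple q = q • (X : Fin ν → MvPowerSeries (Fin ν) ℂ) := by
    funext j
    rw [diagTuple, Pi.smul_apply', smul_eq_C_mul]
  rw [comp, h1, ← rescale_eq_subst, coeff_rescale, monomialValue,
    Finsupp.prod_fintype _ _ fun _ => pow_zero _]

theorem monomialValue_single (q : Fin ν → ℂ) (j : Fin ν) :
    monomialValue q (Finsupp.single j 1) = q j := by
  rw [monomialValue, Finset.prod_eq_single_of_mem j (Finset.mem_univ j)]
  · simp
  · intro i _ hi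
    simp [Finsupp.single_eq_of_ne hi]

/-- Precomposition with `R_q` multiplies the coefficient at `m` by `q^m`; dividing by `q_i` leaves
the nonlinearity `a` free of constants. -/
theorem linearizesDiffeo_iff {q : Fin ν → ℂ} (hq : ∀ i, q i ≠ 0) {a h : Tuple ν}
    (ha : a ∈ nonlinearTuples ν) :
    LinearizesDiffeo q (comp (diagTuple q) (idTuple ν + a)) h ↔
      Solves (fun i m => monomialValue q m / q i - 1) a h := by
  refine and_congr_right fun hh => ?_
  rw [funext_iff]
  refine forall_congr' fun i => ?_
  have h0 := constantCoeff_of_mem_tangentToId hh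
  have hs := hasSubst_of_constantCoeff_zero h0
  have hL : comp (comp (diagTuple q) (idTuple ν + a)) h i = C (q i) * (h i + comp a h i) := by
    rw [comp, comp_diagTuple_id_add q ha, ← smul_eq_C_mul, ← smul_eq_C_mul, subst_smul hs,
      subst_add hs, subst_X hs, comp]
  rw [hL, MvPowerSeries.ext_iff]
  refine forall_congr' fun m => ?_
  rw [coeff_comp_diagTuple, coeff_C_mul, map_add]
  by_cases hm : m.degree ≤ 1
  · refine iff_of_true ?_ fun h2 => by omega
    rw [comp, coeff_subst_of_degree_le_one h0 (ha i) hm, add_zero,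
      mem_tangentToId_iff.1 hh i m hm]
    by_cases hmi : m = Finsupp.single i 1
    · rw [hmi, monomialValue_single]
    · rw [coeff_X_eq_zero_of_ne hmi, mul_zero, mul_zero]
  · have hm : 2 ≤ m.degree := by omega
    rw [imp_iff_right hm, sub_mul, one_mul, sub_eq_iff_eq_add', div_mul_eq_mul_div,
      div_eq_iff (hq i), eq_comm, mul_comm (q i)]

theorem linearization_diffeo (q : Fin ν → ℂ) (a : Tuple ν) (hq : ∀ i, q i ≠ 0)
    (ha : a ∈ nonlinearTuples ν) (hg : Convergent (comp (diagTuple q) (idTuple ν + a)))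
    (hres : NonResonantDiffeo q) (hB : BrunoSeriesDiffeo q < ⊤) :
    ∃ h : Tuple ν, LinearizesDiffeo q (comp (diagTuple q) (idTuple ν + a)) h ∧
      (∀ h', LinearizesDiffeo q (comp (diagTuple q) (idTuple ν + a)) h' → h' = h) ∧
      Convergent h := by
  simp only [linearizesDiffeo_iff hq ha]
  -- The distance to the integers is attained, so distance zero would exponentiate to a resonance.
  have hpos : ∀ j (m : Fin ν →₀ ℕ), 2 ≤ m.degree →
      0 < distInt (pairing m (exponents q) - exponents q j) := by
    intro j m hm
    refine lt_of_le_of_ne Metric.infDist_nonneg fun h0 => hres j m hm ?_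
    obtain ⟨n, hn⟩ := exists_distInt_eq (pairing m (exponents q) - exponents q j)
    have h1 := exp_divisor hq j m
    rw [← exp_two_pi_I_mul_sub_int _ n, norm_eq_zero.1 (hn.symm.trans h0.symm), mul_zero,
      Complex.exp_zero, eq_div_iff (hq j), one_mul] at h1
    exact h1
  have H := brunoBounds_of_quasinorm distInt_sub_le hpos
    (smallDivisorsDiffeo_isLeast (exponents q)) hB
  refine exists_unique_convergent_solution H one_half_pos (by norm_num) (fun i m _ => ?_) ha
    fun i => ?_
  · rw [← exp_divisor hq]
    exact half_min_distInt_le _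
  · refine seriesConvergent_of_coeff_le (hg i) (K := ‖q i‖⁻¹) fun m => ?_
    by_cases hm : m.degree ≤ 1
    · rw [ha i m hm, norm_zero]; positivity
    · have hX : coeff m (X i : MvPowerSeries (Fin ν) ℂ) = 0 :=
        coeff_X_eq_zero_of_ne (by rintro rfl; simp at hm)
      rw [comp_diagTuple_id_add q ha, coeff_C_mul, map_add, hX, zero_add, norm_mul,
        inv_mul_cancel_left₀ (norm_ne_zero_iff.2 (hq i))]

end BrunoLin

end

theorem mainTheorem1 :
    -- (i) diffeomorphisms `g = R_q ∘ (id + a)`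
    (∀ (ν : ℕ) (q : Fin ν → ℂ) (a : BrunoLin.Tuple ν),
      (∀ i, q i ≠ 0) →
      a ∈ BrunoLin.nonlinearTuples ν →
      BrunoLin.Convergent
        (BrunoLin.comp (BrunoLin.diagTuple q) (BrunoLin.idTuple ν + a)) →
      BrunoLin.NonResonantDiffeo q →
      BrunoLin.BrunoSeriesDiffeo q < ⊤ →
      ∃ h : BrunoLin.Tuple ν,
        BrunoLin.LinearizesDiffeo q
          (BrunoLin.comp (BrunoLin.diagTuple q) (BrunoLin.idTuple ν + a)) h ∧
        (∀ h' : BrunoLin.Tuple ν,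
          BrunoLin.LinearizesDiffeo q
            (BrunoLin.comp (BrunoLin.diagTuple q) (BrunoLin.idTuple ν + a)) h' → h' = h) ∧
        BrunoLin.Convergent h) ∧
    -- (ii) vector fields `V = V_lam + a`
    (∀ (ν : ℕ) (lam : Fin ν → ℂ) (a : BrunoLin.Tuple ν),
      a ∈ BrunoLin.nonlinearTuples ν →
      BrunoLin.Convergent (BrunoLin.diagTuple lam + a) →
      BrunoLin.NonResonantField lam →
      BrunoLin.BrunoSeriesField lam < ⊤ →
      ∃ h : BrunoLin.Tuple ν,
        BrunoLin.LinearizesField lam (BrunoLin.diagTuple lam + a) h ∧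
        (∀ h' : BrunoLin.Tuple ν,
          BrunoLin.LinearizesField lam (BrunoLin.diagTuple lam + a) h' → h' = h) ∧
        BrunoLin.Convergent h) := by
  exact ⟨fun _ q a hq ha hg hres hB => BrunoLin.linearization_diffeo q a hq ha hg hres hB,
    fun _ lam a ha hV hres hB => BrunoLin.linearization_field lam a ha hV hres hB⟩
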